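/- Consider the synchronous message-passing model: an $n$-vertex graph $G=(V,E)$ whose vertices are processors with distinct identity numbers from $\{1,\dots,n\}$; each vertex initially knows $n$, its own identity number and its incident communication ports; in every round each vertex may send a message (of any size) over each incident edge; local computation is free; the running time is the number of rounds until all vertices have terminated. For a partition $Q$ of $V$ into clusters, let ${\cal G}(Q)$ be the supergraph whose vertices are the clusters, two distinct clusters being adjacent if some edge of $G$ joins them. $Q$ is a strong $(d,\ell)$-network-decomposition if any two vertices of a cluster $C$ are at distance at most $d$ in the induced subgraph $G(C)$ and ${\cal G}(Q)$ is $\ell$-colorable (has a proper coloring with at most $\ell$ colors). An $L$-labeling of $Q$ is a proper coloring of ${\cal G}(Q)$ with colors from $\{1,\dots,\lfloor L\rfloor\}$. An H-partition of length $k$ and degree at most $a$ of a graph is a partition of its vertex set into (possibly empty) sets $S_1,\dots,S_k$ such that every vertex of $S_i$ has at most $a$ neighbors in $\bigcup_{j\ge i}S_j$. Let $\log^* n$ be the least number of applications of $\log_2$ that bring $n$ down to at most $1$. There is a universal constant $C>0$ (independent of $k$, $n$ and $G$) such that for every positive integer $k$ and every $n$-vertex graph $G$ the following holds. (1) A deterministic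 algorithm computes, in at most $(C\log n)^{k-1}$ time, a strong $((C\log n)^{k-1},\,n^{1/k})$-network-decomposition $Q$ of $G$ together with an H-partition $(S_1,\dots,S_k)$ of length $k$ and degree at most $C\,n^{1/k}$ of ${\cal G}(Q)$: each vertex outputs the name of its cluster and the index $i$ of the set $S_i$ that contains its cluster. (2) A deterministic algorithm computes the same decomposition $Q$ together with a $C\,n^{2/k}$-labeling of $Q$ in at most $(C\log n)^{k-1}\cdot\log^* n$ time: each vertex outputs the name of its cluster and the label of its cluster. -/

import Mathlib

/-! ### Partitions, network-decompositions, H-partitions and labelings -/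

/-- The cluster of the partition `Q` (given as an equivalence relation) named by the class `X`. -/
def cluster {V : Type*} (Q : Setoid V) (X : Quotient Q) : Set V :=
  {v | Quotient.mk Q v = X}

/-- The supergraph obtained from `G` by contracting every cluster of the partition `Q`:
distinct clusters are adjacent when some edge of `G` joins them. -/
def supergraph {V : Type*} (G : SimpleGraph V) (Q : Setoid V) : SimpleGraph (Quotient Q) where
  Adj X Y := X ≠ Y ∧ ∃ u ∈ cluster Q X, ∃ v ∈ cluster Q Y, G.Adj u v
  symm := ⟨fun _ _ ⟨hne, u, hu, v, hv, h⟩ => ⟨hne.symm, v, hv, u, hu, h.symm⟩⟩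
  loopless := ⟨fun _ h => h.1 rfl⟩

/-- Every cluster has strong diameter at most `d`: any two of its vertices are joined by a path of
length at most `d` inside the subgraph induced by the cluster (so clusters are connected). -/
def StrongDiameterLE {V : Type*} (G : SimpleGraph V) (Q : Setoid V) (d : ℝ) : Prop :=
  ∀ (X : Quotient Q) (u v : cluster Q X),
    ∃ p : (G.induce (cluster Q X)).Walk u v, (p.length : ℝ) ≤ d

/-- `Q` is a strong `(d, l)`-network-decomposition of `G`: clusters have strong diameter at most `d`
and the supergraph admits a proper coloring with at most `l` colors. -/
def IsStrongNetworkDecomposition {V : Type*} (G : SimpleGraph V) (Q : Setoid V) (d l : ℝ) : Prop :=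
  StrongDiameterLE G Q d ∧ ∃ m : ℕ, (m : ℝ) ≤ l ∧ (supergraph G Q).Colorable m

/-- The function `h` describes an H-partition of `G` of length `k` and degree at most `a`, with
parts `H_i = {x | h x = i}` (which may be empty): each vertex of `H_i` has at most `a` neighbors in
the union of the parts `H_j` with `j ≥ i`. -/
def IsHPartition {W : Type*} [Finite W] (G : SimpleGraph W) {k : ℕ} (h : W → Fin k) (a : ℝ) : Prop :=
  ∀ x : W, (Set.ncard {y | G.Adj x y ∧ h x ≤ h y} : ℝ) ≤ a

/-- `lab` is an `L`-labeling of the network-decomposition `Q`: a proper coloring of its supergraph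
with colors from `{1, …, ⌊L⌋}`. -/
def IsLabeling {V : Type*} (G : SimpleGraph V) (Q : Setoid V) (lab : Quotient Q → ℕ) (L : ℝ) : Prop :=
  (∀ X, 1 ≤ lab X ∧ (lab X : ℝ) ≤ L) ∧ ∀ X Y, (supergraph G Q).Adj X Y → lab X ≠ lab Y

/-! ### The synchronous message-passing model -/

/-- A network on the vertex set `V`: a graph, unique identity numbers from `{1, …, n}`, `n = |V|`,
and at each vertex `v` an arbitrary numbering `0, …, deg v - 1` of its incident edges (ports). -/
structure Network (V : Type*) [Fintype V] where
  graph : SimpleGraph V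
  ident : V → ℕ
  ident_injective : Function.Injective ident
  ident_mem : ∀ v, 1 ≤ ident v ∧ ident v ≤ Fintype.card V
  deg : V → ℕ
  port : ∀ v, Fin (deg v) ≃ graph.neighborSet v

/-- A deterministic distributed algorithm with an integer parameter. All vertices run the same
program; local computation is free and messages may have any size. -/
structure DistributedAlgorithm (Out : Type) where
  /-- local states of a vertex -/
  State : Type
  /-- messages -/
  Msg : Type
  /-- initial state, from the number of vertices, the parameter, the vertex' own identity number
  and its number of ports -/
  init : (n k ident deg : ℕ) → State
  /-- the message sent over the port with the given number -/
  send : State → (port : ℕ) → Msg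
  /-- the next state, from the list of what arrived over the ports, in the order of the ports
  (`none` if the neighbor behind the port has terminated) -/
  step : State → List (Option Msg) → State
  /-- `some o` if the vertex terminates with output `o`, `none` if it goes on -/
  output : State → Option Out

namespace DistributedAlgorithm

variable {Out : Type} {V : Type*} [Fintype V]

/-- Given the local states `s` of all vertices, what arrives at `v` over its ports. A message sent
by `u` to `v` is the one `u` sends over its own port that leads to `v`. -/
def inbox (A : DistributedAlgorithm Out) (N : Network V) (s : V → A.State) (v : V) :
    List (Option A.Msg) :=
  List.ofFn fun i : Fin (N.deg v) =>
    if (A.output (s (N.port v i).1)).isSome then none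
    else some (A.send (s (N.port v i).1)
      ((N.port (N.port v i).1).symm ⟨v, (N.port v i).2.symm⟩).1)

/-- The local states of all vertices after `t` synchronous rounds, run with parameter `k`.
Terminated vertices change no more. -/
def stateAfter (A : DistributedAlgorithm Out) (N : Network V) (k : ℕ) : ℕ → V → A.State
  | 0, v => A.init (Fintype.card V) k (N.ident v) (N.deg v)
  | t + 1, v =>
      if (A.output (stateAfter A N k t v)).isSome then stateAfter A N k t v
      else A.step (stateAfter A N k t v) (A.inbox N (stateAfter A N k t) v)

/-- On the network `N` with parameter `k`, within time `T` (a number of rounds) all vertices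
terminate, vertex `v` with output `out v`. -/
def ComputesWithin (A : DistributedAlgorithm Out) (N : Network V) (k : ℕ) (T : ℝ) (out : V → Out) :
    Prop :=
  ∃ t : ℕ, (t : ℝ) ≤ T ∧ ∀ v, A.output (A.stateAfter N k t v) = some (out v)

end DistributedAlgorithm

/-- The iterated logarithm: the least number of applications of the binary logarithm that bring
`n` down to at most `1`. -/
noncomputable def logStar (n : ℕ) : ℕ :=
  sInf {i : ℕ | (Real.logb 2)^[i] (n : ℝ) ≤ 1}

/-- The partition of the vertices into sets of vertices with the same cluster name. -/
def partitionOfNames {V : Type*} (name : V → ℕ) : Setoid V := Setoid.ker name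

/-- The set in the definition of the iterated logarithm is never empty. -/
theorem exists_iterate_logb_le_one (x : ℝ) : ∃ i : ℕ, (Real.logb 2)^[i] x ≤ 1 := by
  have key : ∀ m : ℕ, ∀ x : ℝ, x ≤ 1 + m / 4 → ∃ i : ℕ, (Real.logb 2)^[i] x ≤ 1 := by
    intro m
    induction m with
    | zero => intro x h; exact ⟨0, by simpa using h⟩
    | succ m ih =>
      intro x h
      by_cases h1 : x ≤ 1
      · exact ⟨0, by simpa using h1⟩
      · obtain ⟨i, hi⟩ := ih (Real.logb 2 x) (by
          push_cast at h
          have hl := Real.log_two_gt_d9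
          have h2 := Real.log_le_sub_one_of_pos (show 0 < x / 2 by linarith)
          rw [Real.log_div (by linarith) (by norm_num)] at h2
          rw [Real.logb, div_le_iff₀ (by linarith)]
          have := Real.log_two_lt_d9
          nlinarith)
        exact ⟨i + 1, by simpa using hi⟩
  obtain ⟨m, hm⟩ := exists_nat_ge (4 * (x - 1))
  exact key m x (by linarith)

/-! Put `b = ⌊n^{1/k}⌋` and let `B` be the number of binary digits of the identity numbers. Start
from singleton clusters, all active, and run `k - 1` phases on the graph of active clusters. In a
phase, take the clusters with at least `b` active neighbors and thin them out, one binary digit per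
stage, to a ruling set: the closed neighborhoods of its members are disjoint, yet every such cluster
is within `2 * B` steps of a member. New clusters grow around the members for `2 * B` steps. What is
not reached has fewer than `b` active neighbors and retires with the number of the phase as its
mark.

Disjointness divides the number of active clusters by at least `b + 1` per phase
(`card_activeNames_succ`), so since `n < (b + 1) ^ k` at most `b` clusters survive; they get the
mark `k`. Hence every cluster has fewer than `b` neighbors of equal or larger mark
(`ncard_upRel_lt`): the marks form the H-partition, and greedy coloring from the largest mark
downwards uses `b` colors (`colorable_of_ncard_lt`). A phase multiplies diameters and locality radii
by `O(B) = O(log n)` (`exists_clusterRadiusLE_decomp`, `isGraphLocal_decomp`).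

For the labels, Linial's polynomial color reduction runs along the relation towards equal or larger
marks and ends with `O(b²)` colors. It needs only `K ^ (k - 1)` rounds, `K` an absolute constant
(`exists_short_colorReductionChain`): either `b` is at least the bit length of `n + 1` and two
rounds suffice, or that bit length is polynomial in `k`. So `log* n` enters only as a factor that is
at least `1`.

No message protocol is designed. All outputs are functionals of the edge relation on identity
numbers; one that depends only on the view of depth `t` is computed in `t` rounds by gathering that
view (`gather_computesWithin`). What remains is to bound locality, also through contraction of
clusters (`agree_quotRel`). -/

/-! ### Views and local functionals -/

/-- Two relations agree near `x` up to depth `t`: vertices reached from `x` in fewer than `t` steps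
have the same neighbors. -/
def Agree (R R' : ℕ → ℕ → Prop) : ℕ → ℕ → Prop
  | 0, _ => True
  | t + 1, x => ∀ y, (R x y ↔ R' x y) ∧ (R x y → Agree R R' t y)

namespace Agree

variable {R R' : ℕ → ℕ → Prop}

theorem refl (R : ℕ → ℕ → Prop) : ∀ t x, Agree R R t x
  | 0, _ => trivial
  | t + 1, _ => fun y => ⟨Iff.rfl, fun _ => refl R t y⟩

theorem symm : ∀ {t x}, Agree R R' t x → Agree R' R t x
  | 0, _, _ => trivial
  | _ + 1, _, h => fun y => ⟨(h y).1.symm, fun hy => ((h y).2 ((h y).1.2 hy)).symm⟩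

theorem of_succ : ∀ {t x}, Agree R R' (t + 1) x → Agree R R' t x
  | 0, _, _ => trivial
  | _ + 1, _, h => fun y => ⟨(h y).1, fun hy => ((h y).2 hy).of_succ⟩

theorem mono {s t x} (hst : s ≤ t) (h : Agree R R' t x) : Agree R R' s x := by
  induction hst with
  | refl => exact h
  | step _ ih => exact ih h.of_succ

theorem neighbor {t x y} (h : Agree R R' (t + 1) x) (hy : R x y) : Agree R R' t y := (h y).2 hy

theorem iff {t x} (h : Agree R R' (t + 1) x) (y : ℕ) : R x y ↔ R' x y := (h y).1

end Agree

/-- The functional `F` of relations is `t`-local: its value at `x` is determined by the part of the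
relation that can be seen from `x` in `t` steps. -/
def IsLocal {X : Type*} (t : ℕ) (F : (ℕ → ℕ → Prop) → ℕ → X) : Prop :=
  ∀ R R' x, Agree R R' t x → F R x = F R' x

/-- The functional `F` is `t`-local on symmetric relations. -/
def IsGraphLocal {X : Type*} (t : ℕ) (F : (ℕ → ℕ → Prop) → ℕ → X) : Prop :=
  ∀ R R' : ℕ → ℕ → Prop, (∀ x y, R x y → R y x) → (∀ x y, R' x y → R' y x) →
    ∀ x, Agree R R' t x → F R x = F R' x

/-! ### Every local functional is computed by a distributed algorithm -/

/-- The edge relation of a network on the identity numbers. -/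
def Network.rel {V : Type*} [Fintype V] (N : Network V) (a b : ℕ) : Prop :=
  ∃ u v, N.graph.Adj u v ∧ N.ident u = a ∧ N.ident v = b

theorem Network.rel_symm {V : Type*} [Fintype V] (N : Network V) (a b : ℕ) (h : N.rel a b) :
    N.rel b a := by
  obtain ⟨u, v, huv, hu, hv⟩ := h
  exact ⟨v, u, huv.symm, hv, hu⟩

/-- Local state of the gathering algorithm: the input of the vertex, a clock, and the set of the
symmetric relations that are consistent with what the vertex has learned. -/
structure GatherState where
  size : ℕ
  param : ℕ
  ident : ℕ
  time : ℕ
  candidates : Set (ℕ → ℕ → Prop)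

open Classical in
/-- The algorithm that collects information for `τ n k` rounds and then evaluates `F n k`. -/
noncomputable def gather (τ : ℕ → ℕ → ℕ) {Out : Type} [Inhabited Out]
    (F : ℕ → ℕ → (ℕ → ℕ → Prop) → ℕ → Out) : DistributedAlgorithm Out where
  State := GatherState
  Msg := ℕ × Set (ℕ → ℕ → Prop)
  init n k i _ := ⟨n, k, i, 0, {R | ∀ x y, R x y → R y x}⟩
  send s _ := (s.ident, s.candidates)
  step s l := ⟨s.size, s.param, s.ident, s.time + 1,
    {R | R ∈ s.candidates ∧
      ∀ y, (R s.ident y ↔ ∃ K, some (y, K) ∈ l) ∧ ∀ K, some (y, K) ∈ l → R ∈ K}⟩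
  output s := if τ s.size s.param ≤ s.time then
      some (if h : s.candidates.Nonempty then F s.size s.param h.some s.ident else default)
    else none

/-- The update of the candidate set mirrors the recursion in `Agree`: a vertex learns who its
neighbors are and intersects with their candidate sets. All vertices stop at the same round `τ`, so
up to then no port delivers `none`. -/
theorem gather_stateAfter (τ : ℕ → ℕ → ℕ) {Out : Type} [Inhabited Out]
    (F : ℕ → ℕ → (ℕ → ℕ → Prop) → ℕ → Out) {V : Type*} [Fintype V] (N : Network V) (k : ℕ) :
    ∀ t ≤ τ (Fintype.card V) k, ∀ v, (gather τ F).stateAfter N k t v =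
      (⟨Fintype.card V, k, N.ident v, t,
        {R | (∀ x y, R x y → R y x) ∧ Agree N.rel R t (N.ident v)}⟩ : GatherState) := by
  intro t
  induction t with
  | zero =>
    intro _ v
    simp [DistributedAlgorithm.stateAfter, gather, Agree]
  | succ t ih =>
    intro ht v
    have ih' := ih (by omega)
    have hout : ∀ u, ((gather τ F).output ((gather τ F).stateAfter N k t u)).isSome = false := by
      intro u
      rw [ih']
      have : ¬ τ (Fintype.card V) k ≤ t := by omega
      exact congrArg Option.isSome (if_neg this)
    have hmem : ∀ (y : ℕ) (K : Set (ℕ → ℕ → Prop)),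
        some (y, K) ∈ (gather τ F).inbox N ((gather τ F).stateAfter N k t) v ↔
          ∃ u, N.graph.Adj v u ∧ N.ident u = y ∧ {R | (∀ x y, R x y → R y x) ∧ Agree N.rel R t (N.ident u)} = K := by
      intro y K
      have hin : (gather τ F).inbox N ((gather τ F).stateAfter N k t) v =
          List.ofFn fun i => some (N.ident (N.port v i).1,
            {R | (∀ x y, R x y → R y x) ∧ Agree N.rel R t (N.ident (N.port v i).1)}) := by
        unfold DistributedAlgorithm.inbox
        congr 1
        funext i
        rw [hout, ih']
        rfl
      rw [hin]
      refine List.mem_ofFn.trans ?_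
      simp only [Option.some.injEq, Prod.mk.injEq]
      constructor
      · rintro ⟨i, hi⟩
        exact ⟨(N.port v i).1, (N.port v i).2, hi⟩
      · rintro ⟨u, hu, hi⟩
        refine ⟨(N.port v).symm ⟨u, hu⟩, ?_⟩
        rw [Equiv.apply_symm_apply]
        exact hi
    rw [DistributedAlgorithm.stateAfter, hout v, ih']
    have hrel : ∀ y, N.rel (N.ident v) y ↔ ∃ u, N.graph.Adj v u ∧ N.ident u = y := by
      intro y
      constructor
      · rintro ⟨a, b, hab, ha, hb⟩
        exact ⟨b, N.ident_injective ha ▸ hab, hb⟩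
      · rintro ⟨u, hu, hy⟩
        exact ⟨v, u, hu, rfl, hy⟩
    simp only [gather, Bool.false_eq_true, if_false, GatherState.mk.injEq, true_and]
    ext R
    have key : ∀ y, ((R (N.ident v) y ↔ ∃ K, some (y, K) ∈
          (gather τ F).inbox N ((gather τ F).stateAfter N k t) v) ∧
        ∀ K, some (y, K) ∈ (gather τ F).inbox N ((gather τ F).stateAfter N k t) v → R ∈ K) ↔
        ((N.rel (N.ident v) y ↔ R (N.ident v) y) ∧
          (N.rel (N.ident v) y → (∀ x y, R x y → R y x) ∧ Agree N.rel R t y)) := by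
      intro y
      simp only [hmem, hrel]
      constructor
      · rintro ⟨h1, h2⟩
        refine ⟨⟨fun ⟨u, hu, hy⟩ => h1.2 ⟨_, u, hu, hy, rfl⟩,
          fun h => ?_⟩, fun ⟨u, hu, hy⟩ => ?_⟩
        · obtain ⟨_, u, hu, hy, _⟩ := h1.1 h
          exact ⟨u, hu, hy⟩
        · have := h2 _ ⟨u, hu, hy, rfl⟩
          rwa [hy] at this
      · rintro ⟨h1, h2⟩
        refine ⟨⟨fun h => ?_, fun ⟨_, u, hu, hy, _⟩ => h1.1 ⟨u, hu, hy⟩⟩, ?_⟩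
        · obtain ⟨u, hu, hy⟩ := h1.2 h
          exact ⟨_, u, hu, hy, rfl⟩
        · rintro K ⟨u, hu, hy, rfl⟩
          have := h2 ⟨u, hu, hy⟩
          rwa [← hy] at this
    constructor
    · rintro ⟨⟨hsym, _⟩, hR⟩
      exact ⟨hsym, fun y => ⟨((key y).1 (hR y)).1, fun hy => (((key y).1 (hR y)).2 hy).2⟩⟩
    · rintro ⟨hsym, hag⟩
      exact ⟨⟨hsym, hag.of_succ⟩, fun y => (key y).2 ⟨(hag y).1, fun hy => ⟨hsym, (hag y).2 hy⟩⟩⟩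

theorem gather_computesWithin (τ : ℕ → ℕ → ℕ) {Out : Type} [Inhabited Out]
    (F : ℕ → ℕ → (ℕ → ℕ → Prop) → ℕ → Out) {V : Type*} [Fintype V] (N : Network V) (k : ℕ)
    (hF : IsGraphLocal (τ (Fintype.card V) k) (F (Fintype.card V) k)) {T : ℝ}
    (hT : (τ (Fintype.card V) k : ℝ) ≤ T) :
    (gather τ F).ComputesWithin N k T fun v => F (Fintype.card V) k N.rel (N.ident v) := by
  refine ⟨_, hT, fun v => ?_⟩
  rw [gather_stateAfter τ F N k _ le_rfl v]
  -- The true relation is always a candidate, so the default output never occurs; by locality any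
  -- other candidate gives the same value.
  have hne : {R | (∀ x y, R x y → R y x) ∧ Agree N.rel R (τ (Fintype.card V) k) (N.ident v)}.Nonempty :=
    ⟨N.rel, N.rel_symm, Agree.refl _ _ _⟩
  simp only [gather, le_refl, if_true, dif_pos hne]
  rw [hF _ _ N.rel_symm hne.some_mem.1 _ hne.some_mem.2]

/-! ### Bounded reachability -/

/-- `y` can be reached from `x` in at most `t` steps along `R`. -/
def Within (R : ℕ → ℕ → Prop) : ℕ → ℕ → ℕ → Prop
  | 0, x, y => x = y
  | t + 1, x, y => x = y ∨ ∃ w, R x w ∧ Within R t w y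

namespace Within

variable {R R' : ℕ → ℕ → Prop}

theorem refl (R : ℕ → ℕ → Prop) : ∀ t x, Within R t x x
  | 0, _ => rfl
  | _ + 1, _ => Or.inl rfl

theorem mono {t x y} (h : ∀ x y, R x y → R' x y) (hw : Within R t x y) : Within R' t x y := by
  induction t generalizing x with
  | zero => exact hw
  | succ t ih =>
    rcases hw with rfl | ⟨w, h1, h2⟩
    · exact .refl _ _ _
    · exact Or.inr ⟨w, h _ _ h1, ih h2⟩

theorem trans {s t x y z} (h : Within R s x y) (h' : Within R t y z) : Within R (s + t) x z := by
  induction s generalizing x with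
  | zero => cases h; simpa using h'
  | succ s ih =>
    rw [Nat.succ_add]
    rcases h with rfl | ⟨w, h1, h2⟩
    · clear ih
      induction t generalizing x s with
      | zero => cases h'; exact .refl _ _ _
      | succ t ih =>
        rcases h' with rfl | ⟨w, h1, h2⟩
        · exact .refl _ _ _
        · exact Or.inr ⟨w, h1, ih _ h2⟩
    · exact Or.inr ⟨w, h1, ih h2⟩

theorem le {s t x y} (hst : s ≤ t) (h : Within R s x y) : Within R t x y := by
  have := h.trans (.refl R (t - s) y)
  rwa [Nat.add_sub_cancel' hst] at this

theorem single {x y} (h : R x y) : Within R 1 x y := Or.inr ⟨y, h, rfl⟩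

theorem symm {t x y} (hR : ∀ x y, R x y → R y x) (h : Within R t x y) : Within R t y x := by
  induction t generalizing x with
  | zero => exact Eq.symm h
  | succ t ih =>
    rcases h with rfl | ⟨w, h1, h2⟩
    · exact .refl _ _ _
    · exact (ih h2).trans (.single (hR _ _ h1))

theorem preserves {t x y} {p : ℕ → Prop} (h : Within R t x y) (hx : p x)
    (hp : ∀ u w, R u w → p u → p w) : p y := by
  induction t generalizing x with
  | zero => cases h; exact hx
  | succ t ih =>
    rcases h with rfl | ⟨w, h1, h2⟩
    · exact hx
    · exact ih h2 (hp _ _ h1 hx)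

theorem agree {s t x y} (h : Within R s x y) (ha : Agree R R' (t + s) x) : Agree R R' t y := by
  induction s generalizing x with
  | zero => cases h; exact ha
  | succ s ih =>
    rcases h with rfl | ⟨w, h1, h2⟩
    · exact ha.mono (by omega)
    · exact ih h2 (ha.neighbor h1)

end Within

/-! ### Ruling sets -/

/-- The closed neighborhoods of `x` and `y ≠ x` meet. -/
def Meets (R : ℕ → ℕ → Prop) (x y : ℕ) : Prop := R x y ∨ ∃ w, R x w ∧ R w y

/-- Stage `j` of the ruling set of the vertices of degree at least `b`: within every group of
vertices whose numbers agree after dropping `j` binary digits, closed neighborhoods are disjoint. -/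
def ruling (b : ℕ) (R : ℕ → ℕ → Prop) : ℕ → ℕ → Prop
  | 0, x => b ≤ {y | R x y}.ncard
  | j + 1, x => ruling b R j x ∧ ¬ (x / 2 ^ j % 2 = 1 ∧ ∃ y, Meets R x y ∧ ruling b R j y ∧
      y / 2 ^ j % 2 = 0 ∧ x / 2 ^ (j + 1) = y / 2 ^ (j + 1))

theorem isLocal_ruling (b j : ℕ) : IsLocal (2 * j + 1) fun R => ruling b R j := by
  induction j with
  | zero =>
    intro R R' x h
    have : {y | R x y} = {y | R' x y} := Set.ext fun y => h.iff y
    simp only [ruling, this]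
  | succ j ih =>
    have half : ∀ R R' x, Agree R R' (2 * j + 1 + 1 + 1) x → ruling b R (j + 1) x →
        ruling b R' (j + 1) x := by
      rintro R R' x h ⟨h1, h2⟩
      refine ⟨Eq.mp (ih R R' x (h.mono (by omega))) h1,
        fun ⟨hx, y, hm, hy, hy2, he⟩ => h2 ⟨hx, y, ?_⟩⟩
      have h' := h.symm
      rcases hm with hm | ⟨w, hw, hwy⟩
      · exact ⟨Or.inl ((h.iff y).2 hm),
          Eq.mp (ih R' R y ((h'.neighbor hm).mono (by omega))) hy, hy2, he⟩
      · have hw' := h'.neighbor hw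
        exact ⟨Or.inr ⟨w, (h.iff w).2 hw, (hw'.iff y).1 hwy⟩,
          Eq.mp (ih R' R y (hw'.neighbor hwy)) hy, hy2, he⟩
    exact fun R R' x h => propext ⟨half R R' x h, half R' R x h.symm⟩

theorem ruling.zero {b : ℕ} {R : ℕ → ℕ → Prop} {j x : ℕ} (h : ruling b R j x) :
    b ≤ {y | R x y}.ncard := by
  induction j with
  | zero => exact h
  | succ j ih => exact ih h.1

theorem Meets.symm {R : ℕ → ℕ → Prop} (hR : ∀ x y, R x y → R y x) {x y : ℕ} (h : Meets R x y) :
    Meets R y x := by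
  rcases h with h | ⟨w, h1, h2⟩
  · exact Or.inl (hR _ _ h)
  · exact Or.inr ⟨w, hR _ _ h2, hR _ _ h1⟩

theorem div_two_pow_succ (x j : ℕ) : x / 2 ^ (j + 1) = x / 2 ^ j / 2 := by
  rw [pow_succ, Nat.div_div_eq_div_mul]

/-- Two survivors either already agreed one stage earlier, or differ in the digit of this stage;
then the one with digit `1` would have been removed because of the other. Once `j` exceeds all bit
lengths, the group condition is vacuous. -/
theorem ruling.separated {b : ℕ} {R : ℕ → ℕ → Prop} (hR : ∀ x y, R x y → R y x) {j x y : ℕ}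
    (hx : ruling b R j x) (hy : ruling b R j y) (he : x / 2 ^ j = y / 2 ^ j) (hne : x ≠ y) :
    ¬ Meets R x y := by
  induction j with
  | zero => simp at he; exact absurd he hne
  | succ j ih =>
    intro hm
    by_cases h : x / 2 ^ j = y / 2 ^ j
    · exact ih hx.1 hy.1 h hm
    · have he' := he
      rw [div_two_pow_succ, div_two_pow_succ] at he'
      rcases Nat.mod_two_eq_zero_or_one (x / 2 ^ j) with h0 | h1
      · exact hy.2 ⟨by omega, x, hm.symm hR, hx.1, h0, he.symm⟩
      · exact hx.2 ⟨h1, y, hm, hy.1, by omega, he⟩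

/-- Whoever is removed in a stage is removed because of a vertex with digit `0`, which survives that
stage and is at most two steps away. -/
theorem exists_ruling_within {b : ℕ} {R : ℕ → ℕ → Prop} {x : ℕ} (h : ruling b R 0 x) (j : ℕ) :
    ∃ y, ruling b R j y ∧ Within R (2 * j) x y := by
  suffices H : ∃ y, ruling b R j y ∧ x / 2 ^ j = y / 2 ^ j ∧ Within R (2 * j) x y by
    obtain ⟨y, h1, _, h2⟩ := H
    exact ⟨y, h1, h2⟩
  induction j with
  | zero => exact ⟨x, h, rfl, rfl⟩
  | succ j ih =>
    obtain ⟨y, h1, h2, h3⟩ := ih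
    by_cases hy : ruling b R (j + 1) y
    · exact ⟨y, hy, by rw [div_two_pow_succ, div_two_pow_succ, h2], h3.le (by omega)⟩
    · have : y / 2 ^ j % 2 = 1 ∧ ∃ z, Meets R y z ∧ ruling b R j z ∧
          z / 2 ^ j % 2 = 0 ∧ y / 2 ^ (j + 1) = z / 2 ^ (j + 1) := by
        by_contra hno
        exact hy ⟨h1, hno⟩
      obtain ⟨_, z, hm, hz, hz0, he⟩ := this
      refine ⟨z, ⟨hz, fun h => by omega⟩, by rw [← he, div_two_pow_succ, div_two_pow_succ, h2], ?_⟩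
      refine h3.trans (t := 2) ?_
      rcases hm with hm | ⟨w, hw, hwz⟩
      · exact (Within.single hm).le (by omega)
      · exact (Within.single hw).trans (.single hwz)

/-! ### Growing clusters around a set -/

open Classical in
/-- In `t` steps, vertices join the clusters that grow around the vertices of `Z`. -/
noncomputable def flood (R : ℕ → ℕ → Prop) (Z : ℕ → Prop) : ℕ → ℕ → Option ℕ
  | 0, x => if Z x then some x else none
  | t + 1, x => if (flood R Z t x).isSome then flood R Z t x
      else if {z | ∃ y, R x y ∧ flood R Z t y = some z}.Nonempty then
        some (sInf {z | ∃ y, R x y ∧ flood R Z t y = some z})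
      else none

section Flood

variable {R : ℕ → ℕ → Prop} {Z : ℕ → Prop}

theorem isLocal_flood {Z : (ℕ → ℕ → Prop) → ℕ → Prop} {r : ℕ} (hZ : IsLocal r Z) (t : ℕ) :
    IsLocal (r + t) fun R => flood R (Z R) t := by
  induction t with
  | zero =>
    intro R R' x h
    simp only [flood]
    rw [hZ R R' x h]
  | succ t ih =>
    intro R R' x h
    have h1 := ih R R' x h.of_succ
    have h2 : {z | ∃ y, R x y ∧ flood R (Z R) t y = some z} =
        {z | ∃ y, R' x y ∧ flood R' (Z R') t y = some z} := by
      ext z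
      refine exists_congr fun y => ?_
      constructor
      · rintro ⟨hy, he⟩
        exact ⟨(h.iff y).1 hy, (ih R R' y (h.neighbor hy)).symm.trans he⟩
      · rintro ⟨hy, he⟩
        have hy' := (h.iff y).2 hy
        exact ⟨hy', (ih R R' y (h.neighbor hy')).trans he⟩
    simp only at h1
    simp only [flood]
    rw [h1, h2]

theorem flood_mono {s t x z : ℕ} (hst : s ≤ t) (h : flood R Z s x = some z) :
    flood R Z t x = some z := by
  induction hst with
  | refl => exact h
  | step _ ih => simp [flood, ih]

theorem flood_self {x : ℕ} (h : Z x) (t : ℕ) : flood R Z t x = some x :=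
  flood_mono (Nat.zero_le t) (by simp [flood, h])

/-- A vertex joins through a neighbor that already belongs to the cluster, and nobody ever leaves;
hence the path to the center stays in the cluster as it is at any later time `T`. This gives strong,
not just weak, diameter. -/
theorem flood_spec {t x z : ℕ} (h : flood R Z t x = some z) : Z z ∧ ∀ T ≥ t,
    Within (fun u w => R u w ∧ flood R Z T u = some z ∧ flood R Z T w = some z) t x z := by
  induction t generalizing x with
  | zero =>
    by_cases hx : Z x
    · simp only [flood, hx, if_true, Option.some.injEq] at h
      exact ⟨h ▸ hx, fun _ _ => h⟩
    · simp [flood, hx] at h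
  | succ t ih =>
    by_cases h1 : (flood R Z t x).isSome
    · have h' : flood R Z t x = some z := by simpa [flood, h1] using h
      exact ⟨(ih h').1, fun T hT => ((ih h').2 T (by omega)).le (by omega)⟩
    by_cases h2 : {z | ∃ y, R x y ∧ flood R Z t y = some z}.Nonempty
    · have hz : sInf {z | ∃ y, R x y ∧ flood R Z t y = some z} = z := by
        rw [flood, if_neg h1, if_pos h2] at h
        exact Option.some.inj h
      obtain ⟨y, hy, hyz⟩ := hz ▸ Nat.sInf_mem h2
      exact ⟨(ih hyz).1, fun T hT => Or.inr ⟨y, ⟨hy, flood_mono hT h,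
        flood_mono (by omega) hyz⟩, (ih hyz).2 T (by omega)⟩⟩
    · rw [flood, if_neg h1, if_neg h2] at h
      exact absurd h (by simp)

theorem isSome_flood {t x z : ℕ} (hz : Z z) (h : Within R t x z) : (flood R Z t x).isSome := by
  induction t generalizing x with
  | zero => cases h; simp [flood, hz]
  | succ t ih =>
    rcases h with rfl | ⟨w, h1, h2⟩
    · simp [flood_self hz]
    · obtain ⟨y, hy⟩ := Option.isSome_iff_exists.1 (ih h2)
      have hne : {z | ∃ y, R x y ∧ flood R Z t y = some z}.Nonempty := ⟨y, w, h1, hy⟩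
      by_cases h3 : (flood R Z t x).isSome
      · simp [flood, h3]
      · rw [flood, if_neg h3, if_pos hne]
        rfl

end Flood

/-! ### Contracting clusters -/

/-- A clustering `s` gives every vertex a cluster name and a mark. In `quotRel R s p`, distinct
names are related when `R` relates vertices of the two clusters whose marks are related by `p`. -/
def quotRel (R : ℕ → ℕ → Prop) (s : ℕ → ℕ × ℕ) (p : ℕ → ℕ → Prop) (x y : ℕ) : Prop :=
  x ≠ y ∧ ∃ u w, R u w ∧ (s u).1 = x ∧ (s w).1 = y ∧ p (s u).2 (s w).2

theorem quotRel_symm {R : ℕ → ℕ → Prop} {s : ℕ → ℕ × ℕ} {p : ℕ → ℕ → Prop}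
    (hR : ∀ x y, R x y → R y x) (hp : ∀ a b, p a b → p b a) (x y : ℕ) (h : quotRel R s p x y) :
    quotRel R s p y x := by
  obtain ⟨hne, u, w, h1, h2, h3, h4⟩ := h
  exact ⟨hne.symm, w, u, hR _ _ h1, h3, h2, hp _ _ h4⟩

/-- Inside its cluster, every vertex reaches the vertex that names the cluster in `D` steps. -/
def ClusterRadiusLE (R : ℕ → ℕ → Prop) (s : ℕ → ℕ × ℕ) (D : ℕ) : Prop :=
  ∀ v, Within (fun u w => R u w ∧ (s u).1 = (s w).1) D v (s v).1

theorem ClusterRadiusLE.within {R : ℕ → ℕ → Prop} {s : ℕ → ℕ × ℕ} {D : ℕ}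
    (h : ClusterRadiusLE R s D) (hR : ∀ x y, R x y → R y x) {u v : ℕ} (huv : (s u).1 = (s v).1) :
    Within (fun u w => R u w ∧ (s u).1 = (s w).1) (2 * D) u v := by
  have h1 := h u
  have h2 := (h v).symm fun x y hxy => ⟨hR _ _ hxy.1, hxy.2.symm⟩
  rw [← huv] at h2
  exact (h1.trans h2).le (by omega)

/-- A path in the contracted relation gives a path in the original relation. -/
theorem Within.of_quotRel {R R₁ S : ℕ → ℕ → Prop} (hR : ∀ x y, R x y → R y x) {s : ℕ → ℕ × ℕ}
    {p : ℕ → ℕ → Prop} {D t v z : ℕ} (hD : ClusterRadiusLE R s D)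
    (hcluster : ∀ u w, R u w → (s u).1 = (s w).1 → R₁ u w)
    (hedge : ∀ u w, R u w → S (s u).1 (s w).1 → p (s u).2 (s w).2 → R₁ u w)
    (hS : ∀ x y, S x y → quotRel R s p x y)
    (h : Within S t (s v).1 z) : Within R₁ (2 * D + t * (2 * D + 1)) v z := by
  induction t generalizing v with
  | zero =>
    cases h
    exact ((hD v).mono fun u w huw => hcluster u w huw.1 huw.2).le (by omega)
  | succ t ih =>
    rcases h with rfl | ⟨y, h1, h2⟩
    · exact ((hD v).mono fun u w huw => hcluster u w huw.1 huw.2).le (by omega)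
    · obtain ⟨_, u, w, huw, hu, rfl, hp⟩ := hS _ _ h1
      have h3 : Within R₁ (2 * D) v u :=
        (hD.within hR hu.symm).mono fun u w huw => hcluster u w huw.1 huw.2
      have h4 := (h3.trans (.single (hedge u w huw (hu ▸ h1) hp))).trans (ih h2)
      exact h4.le (by nlinarith)

/-- Views in the contracted relation are determined by views in the original relation. -/
theorem agree_quotRel {R R' : ℕ → ℕ → Prop} (hR : ∀ x y, R x y → R y x)
    (hR' : ∀ x y, R' x y → R' y x) {s s' : ℕ → ℕ × ℕ} {p : ℕ → ℕ → Prop} {T D : ℕ}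
    (hs : ∀ v, Agree R R' T v → s v = s' v) (hD : ClusterRadiusLE R s D)
    (hD' : ClusterRadiusLE R' s' D) {t v : ℕ} (h : Agree R R' (T + t * (2 * D + 1)) v) :
    Agree (quotRel R s p) (quotRel R' s' p) t (s v).1 := by
  -- The edge behind a contracted step starts at most `2 * D` away inside the cluster of `v`. There
  -- a view of depth `T + 1` is left: one for the edge, `T` for the clustering at its far end.
  have half : ∀ {R R' : ℕ → ℕ → Prop} {s s' : ℕ → ℕ × ℕ}, (∀ x y, R x y → R y x) →
      (∀ v, Agree R R' T v → s v = s' v) → ClusterRadiusLE R s D →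
      ∀ v y, Agree R R' (T + (2 * D + 1)) v → quotRel R s p (s v).1 y →
      quotRel R' s' p (s v).1 y := by
    intro R R' s s' hR hs hD v y h ⟨hne, u, w, h1, h2, h3, h4⟩
    have hu : Agree R R' (T + 1) u :=
      ((hD.within hR h2.symm).mono fun _ _ h => h.1).agree (h.mono (by omega))
    have hw : Agree R R' T w := hu.neighbor h1
    refine ⟨hne, u, w, (hu.iff w).1 h1, ?_, ?_, ?_⟩
    · rw [← hs u hu.of_succ, h2]
    · rw [← hs w hw, h3]
    · rwa [← hs u hu.of_succ, ← hs w hw]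
  induction t generalizing v with
  | zero => trivial
  | succ t ih =>
    intro y
    have hexp : T + (t + 1) * (2 * D + 1) = T + t * (2 * D + 1) + (2 * D + 1) := by ring
    rw [hexp] at h
    have h0 : Agree R R' (T + (2 * D + 1)) v := h.mono (by nlinarith [Nat.zero_le (t * (2 * D + 1))])
    refine ⟨⟨half hR hs hD v y h0, fun hy => ?_⟩, ?_⟩
    · have hv : s v = s' v := hs v (h0.mono (by omega))
      rw [hv] at hy ⊢
      exact half hR' (fun v hv => (hs v hv.symm).symm) hD' v y h0.symm hy
    · rintro ⟨hne, u, w, h1, h2, rfl, h4⟩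
      have hu := ((hD.within hR h2.symm).mono fun _ _ h => h.1).agree (t := T + t * (2 * D + 1) + 1)
        (h.mono (by omega))
      exact ih (hu.neighbor h1)

/-! ### The decomposition -/

/-- The marks of two active vertices. -/
def BothActive (a b : ℕ) : Prop := a = 0 ∧ b = 0

/-- The names of the clusters that grow in a phase with contracted relation `S`. -/
noncomputable def grow (b B : ℕ) (S : ℕ → ℕ → Prop) : ℕ → Option ℕ :=
  flood S (ruling b S B) (2 * B)

/-- The clustering after the given number of phases. The mark of a vertex is `0` as long as it is
active, and the number of the phase that retired its cluster otherwise. -/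
noncomputable def decomp (b B : ℕ) (R : ℕ → ℕ → Prop) : ℕ → ℕ → ℕ × ℕ
  | 0, v => (v, 0)
  | i + 1, v => if (decomp b B R i v).2 = 0 then
      match grow b B (quotRel R (decomp b B R i) BothActive) (decomp b B R i v).1 with
      | none => ((decomp b B R i v).1, i + 1)
      | some z => (z, 0)
    else decomp b B R i v

section Decomp

variable {b B : ℕ} {R : ℕ → ℕ → Prop}

theorem decomp_succ_of_retired {i v : ℕ} (h : (decomp b B R i v).2 ≠ 0) :
    decomp b B R (i + 1) v = decomp b B R i v := by
  rw [decomp, if_neg h]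

theorem decomp_succ_of_none {i v x : ℕ} (h : decomp b B R i v = (x, 0))
    (hx : grow b B (quotRel R (decomp b B R i) BothActive) x = none) :
    decomp b B R (i + 1) v = (x, i + 1) := by
  rw [decomp, if_pos (by rw [h])]
  simp only [h, hx]

theorem decomp_succ_of_some {i v x z : ℕ} (h : decomp b B R i v = (x, 0))
    (hx : grow b B (quotRel R (decomp b B R i) BothActive) x = some z) :
    decomp b B R (i + 1) v = (z, 0) := by
  rw [decomp, if_pos (by rw [h])]
  simp only [h, hx]

theorem decomp_congr_succ {i u v : ℕ} (h : decomp b B R i u = decomp b B R i v) :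
    decomp b B R (i + 1) u = decomp b B R (i + 1) v := by
  rw [decomp, decomp, h]

theorem decomp_congr_of_le {i j u v : ℕ} (hij : i ≤ j) (h : decomp b B R i u = decomp b B R i v) :
    decomp b B R j u = decomp b B R j v := by
  induction hij with
  | refl => exact h
  | step _ ih => exact decomp_congr_succ ih

theorem decomp_of_retired {i j v : ℕ} (hij : i ≤ j) (h : (decomp b B R i v).2 ≠ 0) :
    decomp b B R j v = decomp b B R i v := by
  induction hij with
  | refl => rfl
  | step _ ih => rw [decomp_succ_of_retired (by rwa [ih]), ih]

theorem decomp_mark_le (i v : ℕ) : (decomp b B R i v).2 ≤ i := by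
  induction i with
  | zero => simp [decomp]
  | succ i ih =>
    by_cases h : (decomp b B R i v).2 = 0
    · have h' : decomp b B R i v = ((decomp b B R i v).1, 0) := Prod.ext rfl h
      cases hg : grow b B (quotRel R (decomp b B R i) BothActive) (decomp b B R i v).1 with
      | none => rw [decomp_succ_of_none h' hg]
      | some z => rw [decomp_succ_of_some h' hg]; simp
    · rw [decomp_succ_of_retired h]; omega

/-- `S` lives on all numbers, most of which name no active cluster. As `b ≥ 1`, a center has an
`S`-neighbor, and this is what makes it a genuine name of an active cluster in `decomp_name`. -/
theorem grow_eq_self (hb : 1 ≤ b) {S : ℕ → ℕ → Prop} {x z : ℕ} (h : grow b B S x = some z) :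
    ruling b S B z ∧ grow b B S z = some z ∧ ∃ y, S z y := by
  obtain ⟨h1, _⟩ := flood_spec h
  refine ⟨h1, flood_self h1 _, ?_⟩
  have h2 := h1.zero
  exact Set.nonempty_of_ncard_ne_zero (s := {y | S z y}) (by omega)

theorem decomp_name (hb : 1 ≤ b) (i v : ℕ) :
    decomp b B R i (decomp b B R i v).1 = decomp b B R i v := by
  induction i generalizing v with
  | zero => rfl
  | succ i ih =>
    by_cases h : (decomp b B R i v).2 = 0
    · have h' : decomp b B R i v = ((decomp b B R i v).1, 0) := Prod.ext rfl h
      cases hg : grow b B (quotRel R (decomp b B R i) BothActive) (decomp b B R i v).1 with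
      | none =>
        rw [decomp_succ_of_none h' hg]
        exact decomp_succ_of_none ((ih v).trans h') hg
      | some z =>
        rw [decomp_succ_of_some h' hg]
        obtain ⟨_, h2, y, _, u, w, _, hu, _, hu0, _⟩ := grow_eq_self hb hg
        have hz : decomp b B R i z = (z, 0) := by
          rw [← hu, ih u]
          exact Prod.ext rfl hu0
        exact decomp_succ_of_some hz h2
    · rw [decomp_succ_of_retired h, decomp_succ_of_retired (by rwa [ih]), ih]

theorem decomp_eq_of_name_eq (hb : 1 ≤ b) {i u v : ℕ}
    (h : (decomp b B R i u).1 = (decomp b B R i v).1) : decomp b B R i u = decomp b B R i v := by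
  rw [← decomp_name hb i u, h, decomp_name hb]

/-- A bound for the diameters of the clusters after `i` phases and for the number of rounds in
which they are computed. -/
def reach (B i : ℕ) : ℕ := (8 * B + 3) ^ i

/-- The radius `D` is chosen before `R`, so that the locality proofs can use the same `D` for the
two relations they compare. -/
theorem exists_clusterRadiusLE_decomp (hb : 1 ≤ b) (B i : ℕ) :
    ∃ D, 2 * D + 1 ≤ reach B i ∧ ∀ R : ℕ → ℕ → Prop, (∀ x y, R x y → R y x) →
      ClusterRadiusLE R (decomp b B R i) D := by
  induction i with
  | zero => exact ⟨0, by simp [reach], fun R _ v => rfl⟩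
  | succ i ih =>
    obtain ⟨D, hDr, hD⟩ := ih
    -- The bound of `Within.of_quotRel` for `2 * B` growth steps: each of them crosses an old
    -- cluster and one edge.
    refine ⟨2 * D + 2 * B * (2 * D + 1), ?_, fun R hR v => ?_⟩
    · have h1 : 2 * (2 * D + 2 * B * (2 * D + 1)) + 1 ≤ (8 * B + 3) * (2 * D + 1) := by
        nlinarith [Nat.zero_le (B * D)]
      refine h1.trans ?_
      rw [reach, pow_succ, mul_comm]
      exact Nat.mul_le_mul_right _ hDr
    have hD := hD R hR
    have hcoarse : ∀ u w, R u w → (decomp b B R i u).1 = (decomp b B R i w).1 →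
        R u w ∧ (decomp b B R (i + 1) u).1 = (decomp b B R (i + 1) w).1 :=
      fun u w h h' => ⟨h, congrArg Prod.fst (decomp_congr_succ (decomp_eq_of_name_eq hb h'))⟩
    have h1 := (hD v).mono fun u w h => hcoarse u w h.1 h.2
    by_cases h : (decomp b B R i v).2 = 0
    · have h' : decomp b B R i v = ((decomp b B R i v).1, 0) := Prod.ext rfl h
      cases hg : grow b B (quotRel R (decomp b B R i) BothActive) (decomp b B R i v).1 with
      | none => rw [decomp_succ_of_none h' hg]; exact h1.le (by omega)
      | some z =>
        rw [decomp_succ_of_some h' hg]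
        have h2 := (flood_spec hg).2 _ le_rfl
        refine h2.of_quotRel (p := BothActive) hR hD hcoarse ?_ fun x y h => h.1
        rintro u w huw ⟨_, hgu, hgw⟩ ⟨hu, hw⟩
        rw [decomp_succ_of_some (Prod.ext rfl hu) hgu, decomp_succ_of_some (Prod.ext rfl hw) hgw]
        exact ⟨huw, rfl⟩
    · rw [decomp_succ_of_retired h]; exact h1.le (by omega)

theorem isLocal_grow (b B : ℕ) : IsLocal (4 * B + 1) (grow b B) := by
  have h := isLocal_flood (isLocal_ruling b B) (2 * B)
  have e : 2 * B + 1 + 2 * B = 4 * B + 1 := by ring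
  rwa [e] at h

theorem isGraphLocal_decomp (hb : 1 ≤ b) (B i : ℕ) :
    IsGraphLocal (reach B i) fun R => decomp b B R i := by
  induction i with
  | zero => exact fun R R' _ _ x _ => rfl
  | succ i ih =>
    intro R R' hR hR' v h
    obtain ⟨D, hDr, hD⟩ := exists_clusterRadiusLE_decomp hb B i
    have hle : reach B i + (4 * B + 1) * (2 * D + 1) ≤ reach B (i + 1) := by
      have h1 := Nat.mul_le_mul_left (4 * B + 1) hDr
      have h2 : reach B (i + 1) = (8 * B + 3) * reach B i := by rw [reach, reach, pow_succ, mul_comm]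
      nlinarith [Nat.zero_le (B * reach B i)]
    have hv : decomp b B R i v = decomp b B R' i v :=
      ih R R' hR hR' v (h.mono (by omega))
    have hq : Agree (quotRel R (decomp b B R i) BothActive)
        (quotRel R' (decomp b B R' i) BothActive) (4 * B + 1) (decomp b B R i v).1 :=
      agree_quotRel (p := BothActive) hR hR' (fun v => ih R R' hR hR' v) (hD R hR)
        (hD R' hR') (h.mono hle)
    have hg := isLocal_grow b B _ _ _ hq
    rw [hv] at hg
    simp only [decomp, hv, hg]

end Decomp

/-! ### Color reduction -/

/-- `φ` reduces `m` colors to `m'` colors along out-neighborhoods with at most `b` colors: a vertex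
of color `c` whose out-neighbors have the colors `A` gets the new color `φ c A`. -/
def IsColorReducer (b m m' : ℕ) (φ : ℕ → Set ℕ → ℕ) : Prop :=
  (∀ c A, φ c A < m') ∧ ∀ c < m, ∀ c' < m, ∀ A A' : Set ℕ, A.Finite → A.ncard ≤ b → c' ∈ A →
    c ∉ A → φ c A ≠ φ c' A'

theorem exists_injOn_polynomials {q : ℕ} [Fact q.Prime] {d m : ℕ} (hm : m ≤ q ^ (d + 1)) :
    ∃ f : ℕ → Polynomial (ZMod q), (∀ c < m, ∀ c' < m, f c = f c' → c = c') ∧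
      ∀ c, (f c).degree < (d + 1 : ℕ) := by
  have hcard : Fintype.card (Fin m) ≤ Fintype.card (Fin (d + 1) → ZMod q) := by
    simpa [ZMod.card] using hm
  obtain ⟨e⟩ := Function.Embedding.nonempty_of_card_le hcard
  let g := (Polynomial.degreeLTEquiv (ZMod q) (d + 1)).symm
  refine ⟨fun c => if h : c < m then (g (e ⟨c, h⟩) : Polynomial (ZMod q)) else 0, ?_, ?_⟩
  · intro c hc c' hc' h
    simp only [dif_pos hc, dif_pos hc'] at h
    have := e.injective (g.injective (Subtype.ext h))
    simpa using this
  · intro c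
    by_cases h : c < m
    · simp only [dif_pos h]
      exact Polynomial.mem_degreeLT.1 (g (e ⟨c, h⟩)).2
    · simp only [dif_neg h, Polynomial.degree_zero]
      exact WithBot.bot_lt_coe _

/-- Linial's color reduction with polynomials of degree at most `d` over the field with `q`
elements. -/
theorem exists_isColorReducer_sq {b m q d : ℕ} (hq : q.Prime) (hbd : b * d < q)
    (hm : m ≤ q ^ (d + 1)) : ∃ φ, IsColorReducer b m (q ^ 2) φ := by
  classical
  have := Fact.mk hq
  obtain ⟨f, hinj, hdeg⟩ := exists_injOn_polynomials (q := q) (d := d) hm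
  -- The new color encodes a good point together with the value there. Equal new colors would give
  -- an out-neighbor the same value at a point good for `c`, whatever the out-neighbors of that
  -- neighbor are.
  let good (c : ℕ) (A : Set ℕ) (x : ZMod q) : Prop := ∀ e ∈ A, e < m → (f e).eval x ≠ (f c).eval x
  let pt (c : ℕ) (A : Set ℕ) : ZMod q := if h : ∃ x, good c A x then h.choose else 0
  let enc (x y : ZMod q) : ℕ := x.val * q + y.val
  have enc_lt : ∀ x y, enc x y < q ^ 2 := by
    intro x y
    have hx := ZMod.val_lt x
    have hy := ZMod.val_lt y
    simp only [enc]
    nlinarith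
  have enc_inj : ∀ x y x' y', enc x y = enc x' y' → x = x' ∧ y = y' := by
    intro x y x' y' h
    have hy := ZMod.val_lt y
    have hy' := ZMod.val_lt y'
    simp only [enc] at h
    have h1 : x.val = x'.val := by
      have := congrArg (· / q) h
      simpa [mul_comm _ q, Nat.mul_add_div hq.pos, Nat.div_eq_of_lt hy, Nat.div_eq_of_lt hy']
        using this
    rw [h1] at h
    exact ⟨ZMod.val_injective q h1, ZMod.val_injective q (by omega)⟩
  refine ⟨fun c A => enc (pt c A) ((f c).eval (pt c A)), fun c A => enc_lt _ _, ?_⟩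
  intro c hc c' hc' A A' hA hAb hc'A hcA heq
  obtain ⟨h1, h2⟩ := enc_inj _ _ _ _ heq
  -- Bad points are roots of at most `b` nonzero polynomials `f e - f c` of degree at most `d`, and
  -- `b * d < q`.
  have hex : ∃ x, good c A x := by
    by_contra hno
    simp only [good] at hno
    push Not at hno
    let B : Finset ℕ := hA.toFinset.filter (· < m)
    have hcover : (Finset.univ : Finset (ZMod q)) ⊆
        B.biUnion fun e => (f e - f c).roots.toFinset := by
      intro x _
      obtain ⟨e, he, hem, hx⟩ := hno x
      refine Finset.mem_biUnion.2 ⟨e, by simp [B, he, hem], ?_⟩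
      rw [Multiset.mem_toFinset, Polynomial.mem_roots, Polynomial.IsRoot, Polynomial.eval_sub, hx,
        sub_self]
      intro h0
      exact hcA (hinj e hem c hc (sub_eq_zero.1 h0) ▸ he)
    have hle := Finset.card_le_card hcover
    rw [Finset.card_univ, ZMod.card] at hle
    have hsum : (B.biUnion fun e => (f e - f c).roots.toFinset).card ≤ B.card * d := by
      refine Finset.card_biUnion_le_card_mul _ _ _ fun e _ => ?_
      refine (Multiset.toFinset_card_le _).trans ((Polynomial.card_roots' _).trans ?_)
      have := (Polynomial.degree_sub_le (f e) (f c)).trans_lt (max_lt (hdeg e) (hdeg c))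
      exact Polynomial.natDegree_le_iff_degree_le.2 (Order.le_of_lt_succ this)
    have hB : B.card ≤ b := by
      refine (Finset.card_filter_le _ _).trans ?_
      rwa [← Set.ncard_eq_toFinset_card A hA]
    have := Nat.mul_le_mul_right d hB
    omega
  have hg : good c A (pt c A) := by
    simp only [pt, dif_pos hex]
    exact hex.choose_spec
  refine hg c' hc'A hc' ?_
  rw [h2, h1]

theorem exists_isColorReducer_clog {b m : ℕ} (hb : 1 ≤ b) (hm : 2 ≤ m) :
    ∃ m' φ, m' ≤ 4 * b ^ 2 * Nat.clog 2 m ^ 2 ∧ IsColorReducer b m m' φ := by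
  have hd : 0 < Nat.clog 2 m := Nat.clog_pos (by norm_num) hm
  -- Bertrand's postulate, with polynomials of degree at most `Nat.clog 2 m`.
  obtain ⟨q, hq, h1, h2⟩ := Nat.exists_prime_lt_and_le_two_mul (b * Nat.clog 2 m) (by positivity)
  obtain ⟨φ, hφ⟩ := exists_isColorReducer_sq (m := m) hq h1 (by
    calc m ≤ 2 ^ Nat.clog 2 m := Nat.le_pow_clog (by norm_num) m
      _ ≤ q ^ Nat.clog 2 m := Nat.pow_le_pow_left hq.two_le _
      _ ≤ q ^ (Nat.clog 2 m + 1) := Nat.pow_le_pow_right hq.pos (by omega))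
  refine ⟨q ^ 2, φ, ?_, hφ⟩
  calc q ^ 2 ≤ (2 * (b * Nat.clog 2 m)) ^ 2 := Nat.pow_le_pow_left h2 _
    _ = _ := by ring

/-- Polynomials of degree at most `3` over a field with `3 * b < q ≤ 6 * b`; there are `q ^ 4 > 81 *
b ^ 4` of them. This last reduction removes the logarithmic factor. -/
theorem exists_isColorReducer_cubic {b m : ℕ} (hb : 1 ≤ b) (hm : m ≤ 81 * b ^ 4) :
    ∃ m' φ, m' ≤ 36 * b ^ 2 ∧ IsColorReducer b m m' φ := by
  obtain ⟨q, hq, h1, h2⟩ := Nat.exists_prime_lt_and_le_two_mul (b * 3) (by positivity)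
  obtain ⟨φ, hφ⟩ := exists_isColorReducer_sq (m := m) hq h1 (by
    calc m ≤ 81 * b ^ 4 := hm
      _ = (b * 3) ^ 4 := by ring
      _ ≤ q ^ (3 + 1) := Nat.pow_le_pow_left h1.le _)
  refine ⟨q ^ 2, φ, ?_, hφ⟩
  calc q ^ 2 ≤ (2 * (b * 3)) ^ 2 := Nat.pow_le_pow_left h2 _
    _ = _ := by ring

/-- A sequence of `J` color reductions from `m` to `m'` colors. -/
def ColorReductionChain (b : ℕ) (J m m' : ℕ) : Prop :=
  ∃ (μ : ℕ → ℕ) (φ : ℕ → ℕ → Set ℕ → ℕ), μ 0 = m ∧ μ J = m' ∧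
    ∀ j < J, IsColorReducer b (μ j) (μ (j + 1)) (φ j)

theorem ColorReductionChain.refl (b m : ℕ) : ColorReductionChain b 0 m m :=
  ⟨fun _ => m, fun _ _ _ => 0, rfl, rfl, fun _ h => absurd h (by omega)⟩

theorem ColorReductionChain.cons {b J m m₁ m' : ℕ} {φ : ℕ → Set ℕ → ℕ}
    (h : IsColorReducer b m m₁ φ) (hc : ColorReductionChain b J m₁ m') :
    ColorReductionChain b (J + 1) m m' := by
  obtain ⟨μ, ψ, h0, hJ, hs⟩ := hc
  refine ⟨fun j => Nat.casesOn j m μ, fun j => Nat.casesOn j φ ψ, rfl, hJ, fun j hj => ?_⟩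
  cases j with
  | zero => simpa [h0] using h
  | succ j => exact hs j (by omega)

/-- Equality holds at `d = 16`; this is the source of the threshold `2 ^ 16` in the number of
colors. -/
theorem pow_four_lt_two_pow {d : ℕ} (hd : 16 ≤ d) : d ^ 4 ≤ 2 * 2 ^ (d - 1) := by
  obtain ⟨e, rfl⟩ := Nat.exists_eq_add_of_le hd
  induction e with
  | zero => norm_num
  | succ e ih =>
    have h1 : 2 ^ (16 + (e + 1) - 1) = 2 * 2 ^ (16 + e - 1) := by
      rw [← pow_succ']; congr 1; omega
    have ih := ih (by omega)
    rw [h1]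
    refine le_trans ?_ (Nat.mul_le_mul_left 2 ih |>.trans_eq (by ring))
    generalize hx : 16 + e = x at *
    have hx : 16 ≤ x := by omega
    have : 16 + (e + 1) = x + 1 := by omega
    rw [this]
    nlinarith [Nat.mul_le_mul hx hx, Nat.pow_le_pow_left hx 3, Nat.pow_le_pow_left hx 2,
      Nat.mul_le_mul_right (x^3) hx, Nat.mul_le_mul_right (x^2) hx]

/-- Starting from `m` colors, at most `m` reductions lead to `O(b²)` colors. -/
theorem exists_colorReductionChain {b : ℕ} (hb : 1 ≤ b) (m : ℕ) :
    ∃ J ≤ m, ∃ m' ≤ 2 ^ 16 * b ^ 2, ColorReductionChain b J m m' := by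
  induction m using Nat.strong_induction_on with
  | _ m ih =>
    by_cases h1 : m ≤ 2 ^ 16 * b ^ 2
    · exact ⟨0, Nat.zero_le _, m, h1, .refl b m⟩
    have hb2 : 1 ≤ b ^ 2 := Nat.one_le_pow _ _ hb
    have hm : 2 ^ 16 < m := by omega
    by_cases h2 : m ≤ 81 * b ^ 4
    · obtain ⟨m', φ, hm', hφ⟩ := exists_isColorReducer_cubic hb h2
      exact ⟨1, by omega, m', by omega, .cons hφ (.refl b m')⟩
    obtain ⟨m₁, φ, hm₁, hφ⟩ := exists_isColorReducer_clog (m := m) hb (by omega)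
    have hd : 16 < Nat.clog 2 m := (Nat.lt_clog_iff_pow_lt (by norm_num)).2 hm
    have hd4 := pow_four_lt_two_pow hd.le
    have hpow : 2 ^ (Nat.clog 2 m - 1) < m :=
      Nat.pow_pred_clog_lt_self (by norm_num) (by omega)
    set d := Nat.clog 2 m
    -- Compare squares: `16 * b ^ 4 * d ^ 4 ≤ 32 * b ^ 4 * m < m ^ 2`, because `81 * b ^ 4 < m`.
    -- Strict decrease is all that the crude bound on `J` needs.
    have hlt : m₁ < m := by
      refine lt_of_le_of_lt hm₁ (lt_of_pow_lt_pow_left₀ 2 (Nat.zero_le _) ?_)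
      have e : (4 * b ^ 2 * d ^ 2) ^ 2 = 16 * b ^ 4 * d ^ 4 := by ring
      have h3 : b ^ 4 * d ^ 4 ≤ b ^ 4 * (2 * m) := Nat.mul_le_mul_left _ (by omega)
      have h4 : 81 * b ^ 4 * m < m * m := Nat.mul_lt_mul_of_pos_right (by omega) (by omega)
      rw [e, sq]
      nlinarith
    obtain ⟨J, hJ, m', hm', hc⟩ := ih m₁ hlt
    exact ⟨J + 1, by omega, m', hm', .cons hφ hc⟩

/-- From `2 ^ (L - 1) < L ^ k` one gets `L - 1 < s * k` with `s = Nat.clog 2 L`. Since `L - 1 ≥ 2 ^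
(s - 1) ≥ s ^ 2 / 4`, this forces `s < 4 * k`, so `L ^ 4` is exponential in `k` at most. The summand
`2` pays for the first reduction and for the `+ 1` in the round count. -/
theorem log_pow_bound {k n L : ℕ} (hk : 2 ≤ k) (hL : 2 ≤ L) (h1 : 2 ^ (L - 1) ≤ n)
    (h2 : n < L ^ k) : 2 + 4 * L ^ 4 ≤ (2 ^ 35) ^ (k - 1) := by
  set s := Nat.clog 2 L with hs
  have hs1 : 0 < s := Nat.clog_pos (by norm_num) hL
  have hLs : L ≤ 2 ^ s := Nat.le_pow_clog (by norm_num) L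
  have hsL : 2 ^ (s - 1) < L := Nat.pow_pred_clog_lt_self (by norm_num) hL
  have h3 : L - 1 < s * k := by
    refine (Nat.pow_lt_pow_iff_right (by norm_num : 1 < 2)).1 ?_
    calc 2 ^ (L - 1) < L ^ k := h1.trans_lt h2
      _ ≤ (2 ^ s) ^ k := Nat.pow_le_pow_left hLs k
      _ = 2 ^ (s * k) := (pow_mul _ _ _).symm
  have hsq : ∀ s : ℕ, s ^ 2 ≤ 4 * 2 ^ (s - 1) := by
    intro s
    induction s with
    | zero => norm_num
    | succ s ih =>
      rcases lt_or_ge s 3 with h | h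
      · interval_cases s <;> norm_num
      · have e : 2 ^ (s + 1 - 1) = 2 * 2 ^ (s - 1) := by rw [← pow_succ']; congr 1; omega
        rw [e]
        nlinarith
  have h4 : s < 4 * k := by
    have := hsq s
    by_contra hcon
    have h5 : s * (4 * k) ≤ s * s := Nat.mul_le_mul_left s (by omega)
    have h6 : s * (4 * k) = 4 * (s * k) := by ring
    have h7 : s ^ 2 = s * s := sq s
    omega
  have h6 : 4 * s + 3 ≤ 35 * (k - 1) := by omega
  calc 2 + 4 * L ^ 4 ≤ 2 + 4 * (2 ^ s) ^ 4 := by gcongr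
    _ = 2 + 4 * 2 ^ (4 * s) := by rw [← pow_mul, mul_comm s 4]
    _ ≤ 2 ^ (4 * s + 3) := by
      rw [pow_add]
      have : 1 ≤ 2 ^ (4 * s) := Nat.one_le_two_pow
      omega
    _ ≤ 2 ^ (35 * (k - 1)) := Nat.pow_le_pow_right (by norm_num) h6
    _ = _ := pow_mul _ _ _

/-- From `n + 1` colors to `O(b²)` colors, where `b = ⌊n^{1/k}⌋`, in at most `O(1)^{k-1}` steps. -/
theorem exists_short_colorReductionChain {n k b : ℕ} (hn : 2 ≤ n) (hk : 1 ≤ k) (hb : b ^ k ≤ n)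
    (hnb : n < (b + 1) ^ k) : ∃ J, J + 1 ≤ (2 ^ 35) ^ (k - 1) ∧ ∃ m' ≤ 2 ^ 16 * b ^ 2,
      ColorReductionChain b J (n + 1) m' := by
  have hb1 : 1 ≤ b := by
    rcases Nat.eq_zero_or_pos b with rfl | h
    · simp at hnb; omega
    · exact h
  -- For `k = 1` no reduction round is allowed, but then `b = n` and the identity numbers are
  -- already good enough.
  rcases eq_or_lt_of_le hk with rfl | hk2
  · refine ⟨0, by simp, n + 1, ?_, .refl _ _⟩
    simp only [pow_one] at hnb
    nlinarith
  have hL2 : 2 ≤ Nat.clog 2 (n + 1) :=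
    (Nat.lt_clog_iff_pow_lt (by norm_num)).2 (by omega)
  have hLn : 2 ^ (Nat.clog 2 (n + 1) - 1) ≤ n :=
    Nat.lt_succ_iff.1 (Nat.pow_pred_clog_lt_self (by norm_num) (by omega))
  obtain ⟨m₁, φ, hm₁, hφ⟩ := exists_isColorReducer_clog (m := n + 1) hb1 (by omega)
  set L := Nat.clog 2 (n + 1)
  have hK : 2 ^ 35 ≤ (2 ^ 35) ^ (k - 1) := Nat.le_self_pow (by omega) _
  -- If `L ≤ b`, the `4 * b ^ 2 * L ^ 2` colors are within reach of one cubic reduction. Otherwise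
  -- `n < L ^ k`, and even one round per remaining color is affordable.
  rcases le_or_gt L b with hLb | hLb
  · obtain ⟨m', ψ, hm', hψ⟩ := exists_isColorReducer_cubic (m := m₁) hb1 (by
      have : L ^ 2 ≤ b ^ 2 := Nat.pow_le_pow_left hLb 2
      nlinarith)
    exact ⟨2, by omega, m', by omega, .cons hφ (.cons hψ (.refl b m'))⟩
  · obtain ⟨J, hJ, m', hm', hc⟩ := exists_colorReductionChain hb1 m₁
    refine ⟨J + 1, ?_, m', hm', .cons hφ hc⟩
    have h1 := log_pow_bound hk2 hL2 hLn
      (hnb.trans_le (Nat.pow_le_pow_left (by omega) k))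
    have h2 : m₁ ≤ 4 * L ^ 4 := by
      refine hm₁.trans ?_
      have : b ^ 2 ≤ L ^ 2 := Nat.pow_le_pow_left hLb.le 2
      nlinarith
    omega

/-! ### Counting active clusters and degrees towards larger marks -/

section Counting

variable {b B n : ℕ} {R : ℕ → ℕ → Prop}

open Classical in
/-- The names of the clusters of vertices from `{1, …, n}` that are active after `i` phases. -/
noncomputable def activeNames (b B n : ℕ) (R : ℕ → ℕ → Prop) (i : ℕ) : Finset ℕ :=
  (Finset.Icc 1 n).filter fun x => decomp b B R i x = (x, 0)

theorem decomp_name_mem (hb : 1 ≤ b) (hR : ∀ x y, R x y → R y x)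
    (hn : ∀ x y, R x y → x ∈ Finset.Icc 1 n) {v : ℕ} (hv : v ∈ Finset.Icc 1 n) (i : ℕ) :
    (decomp b B R i v).1 ∈ Finset.Icc 1 n := by
  obtain ⟨D, _, hD⟩ := exists_clusterRadiusLE_decomp hb B i
  exact (hD R hR v).preserves hv fun u w h _ => hn w u (hR _ _ h.1)

theorem mem_activeNames (hb : 1 ≤ b) (hR : ∀ x y, R x y → R y x)
    (hn : ∀ x y, R x y → x ∈ Finset.Icc 1 n) {v i : ℕ} (hv : v ∈ Finset.Icc 1 n)
    (h : (decomp b B R i v).2 = 0) : (decomp b B R i v).1 ∈ activeNames b B n R i := by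
  classical
  refine Finset.mem_filter.2 ⟨decomp_name_mem hb hR hn hv i, ?_⟩
  rw [decomp_name hb]
  exact Prod.ext rfl h

theorem mem_activeNames_of_quotRel (hb : 1 ≤ b) (hR : ∀ x y, R x y → R y x)
    (hn : ∀ x y, R x y → x ∈ Finset.Icc 1 n) {i x y : ℕ}
    (h : quotRel R (decomp b B R i) BothActive x y) :
    x ∈ activeNames b B n R i ∧ y ∈ activeNames b B n R i := by
  obtain ⟨_, u, w, huw, rfl, rfl, hu, hw⟩ := h
  exact ⟨mem_activeNames hb hR hn (hn _ _ huw) hu,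
    mem_activeNames hb hR hn (hn _ _ (hR _ _ huw)) hw⟩

theorem finite_quotRel (hb : 1 ≤ b) (hR : ∀ x y, R x y → R y x)
    (hn : ∀ x y, R x y → x ∈ Finset.Icc 1 n) (i x : ℕ) :
    {y | quotRel R (decomp b B R i) BothActive x y}.Finite :=
  (activeNames b B n R i).finite_toSet.subset fun _ hy =>
    (mem_activeNames_of_quotRel hb hR hn hy).2

/-- Each new active name is a ruling vertex, whose closed neighborhood has at least `b + 1` old
active names; all numbers being below `2 ^ B`, these neighborhoods are pairwise disjoint. -/
theorem card_activeNames_succ (hb : 1 ≤ b) (hR : ∀ x y, R x y → R y x)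
    (hn : ∀ x y, R x y → x ∈ Finset.Icc 1 n) (hB : n < 2 ^ B) (i : ℕ) :
    (activeNames b B n R (i + 1)).card * (b + 1) ≤ (activeNames b B n R i).card := by
  classical
  set S := quotRel R (decomp b B R i) BothActive
  have hSsymm : ∀ x y, S x y → S y x := quotRel_symm hR fun _ _ h => ⟨h.2, h.1⟩
  have hact : ∀ x ∈ activeNames b B n R (i + 1), ruling b S B x ∧ x ∈ activeNames b B n R i ∧
      x < 2 ^ B := by
    intro x hx
    obtain ⟨hxn, hx⟩ := Finset.mem_filter.1 hx
    have h0 : (decomp b B R i x).2 = 0 := by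
      by_contra h
      rw [decomp_succ_of_retired h] at hx
      exact h (by rw [hx])
    have h' : decomp b B R i x = ((decomp b B R i x).1, 0) := Prod.ext rfl h0
    cases hg : grow b B S (decomp b B R i x).1 with
    | none => rw [decomp_succ_of_none h' hg] at hx; simp at hx
    | some z =>
      rw [decomp_succ_of_some h' hg] at hx
      obtain rfl : z = x := congrArg Prod.fst hx
      obtain ⟨h1, _, y, hy⟩ := grow_eq_self hb hg
      exact ⟨h1, (mem_activeNames_of_quotRel hb hR hn hy).1,
        (Finset.mem_Icc.1 hxn).2.trans_lt hB⟩
  let nb (x : ℕ) : Finset ℕ := (activeNames b B n R i).filter fun y => y = x ∨ S x y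
  have hcard : ∀ x ∈ activeNames b B n R (i + 1), b + 1 ≤ (nb x).card := by
    intro x hx
    obtain ⟨h1, h2, _⟩ := hact x hx
    have h3 : nb x = insert x (finite_quotRel (B := B) hb hR hn i x).toFinset := by
      ext y
      simp only [nb, Finset.mem_filter, Finset.mem_insert, Set.Finite.mem_toFinset,
        Set.mem_ofPred_eq]
      constructor
      · exact fun h => h.2
      · rintro (rfl | h)
        · exact ⟨h2, Or.inl rfl⟩
        · exact ⟨(mem_activeNames_of_quotRel hb hR hn h).2, Or.inr h⟩
    have h4 : x ∉ (finite_quotRel hb hR hn i x (B := B) (n := n)).toFinset := by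
      simp only [Set.Finite.mem_toFinset]
      exact fun h => h.1 rfl
    rw [h3, Finset.card_insert_of_notMem h4, ← Set.ncard_eq_toFinset_card _ _]
    exact Nat.succ_le_succ h1.zero
  have hdisj : Set.PairwiseDisjoint (activeNames b B n R (i + 1) : Set ℕ) nb := by
    intro x hx y hy hne
    obtain ⟨hx1, _, hx2⟩ := hact x hx
    obtain ⟨hy1, _, hy2⟩ := hact y hy
    refine Finset.disjoint_left.2 fun w hwx hwy => ?_
    refine hx1.separated hSsymm hy1 (by rw [Nat.div_eq_of_lt hx2, Nat.div_eq_of_lt hy2]) hne ?_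
    rcases (Finset.mem_filter.1 hwx).2 with rfl | h1 <;>
      rcases (Finset.mem_filter.1 hwy).2 with rfl | h2
    · exact absurd rfl hne
    · exact Or.inl (hSsymm _ _ h2)
    · exact Or.inl h1
    · exact Or.inr ⟨w, h1, hSsymm _ _ h2⟩
  calc (activeNames b B n R (i + 1)).card * (b + 1)
      ≤ ∑ x ∈ activeNames b B n R (i + 1), (nb x).card := by
        rw [← smul_eq_mul]; exact Finset.card_nsmul_le_sum _ _ _ hcard
    _ = ((activeNames b B n R (i + 1)).biUnion nb).card := (Finset.card_biUnion hdisj).symm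
    _ ≤ _ := Finset.card_le_card (Finset.biUnion_subset.2 fun _ _ => Finset.filter_subset _ _)

theorem card_activeNames_le (hb : 1 ≤ b) (hR : ∀ x y, R x y → R y x)
    (hn : ∀ x y, R x y → x ∈ Finset.Icc 1 n) (hB : n < 2 ^ B) {k : ℕ} (hk : 1 ≤ k)
    (hnb : n < (b + 1) ^ k) : (activeNames b B n R (k - 1)).card ≤ b := by
  classical
  have h : ∀ i, (activeNames b B n R i).card * (b + 1) ^ i ≤ n := by
    intro i
    induction i with
    | zero =>
      simpa [activeNames] using (Finset.card_filter_le (Finset.Icc 1 n) fun x =>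
        decomp b B R 0 x = (x, 0))
    | succ i ih =>
      refine le_trans ?_ ih
      rw [pow_succ, mul_comm _ (b + 1), ← mul_assoc]
      exact Nat.mul_le_mul_right _ (card_activeNames_succ hb hR hn hB i)
  have h1 := (h (k - 1)).trans_lt hnb
  have h2 : (b + 1) ^ k = (b + 1) * (b + 1) ^ (k - 1) := by
    rw [← pow_succ']; congr 1; omega
  rw [h2] at h1
  exact Nat.lt_succ_iff.1 (lt_of_mul_lt_mul_right h1 (Nat.zero_le _))

/-- The final clustering: the clusters that are active after `k - 1` phases get the mark `k`. -/
noncomputable def finalDecomp (b B k : ℕ) (R : ℕ → ℕ → Prop) (v : ℕ) : ℕ × ℕ :=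
  ((decomp b B R (k - 1) v).1,
    if (decomp b B R (k - 1) v).2 = 0 then k else (decomp b B R (k - 1) v).2)

theorem finalDecomp_congr {k i u v : ℕ} (hi : i < k) (h : decomp b B R i u = decomp b B R i v) :
    finalDecomp b B k R u = finalDecomp b B k R v := by
  rw [finalDecomp, finalDecomp, decomp_congr_of_le (by omega : i ≤ k - 1) h]

theorem finalDecomp_eq_of_name_eq (hb : 1 ≤ b) {k u v : ℕ}
    (h : (finalDecomp b B k R u).1 = (finalDecomp b B k R v).1) :
    finalDecomp b B k R u = finalDecomp b B k R v := by
  have h' := decomp_eq_of_name_eq hb h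
  rw [finalDecomp, finalDecomp, h']

theorem exists_phase_of_retired {j v : ℕ} (h : (decomp b B R j v).2 ≠ 0) :
    ∃ i < j, (decomp b B R j v).2 = i + 1 ∧ (decomp b B R i v).2 = 0 ∧
      (decomp b B R i v).1 = (decomp b B R j v).1 ∧
      grow b B (quotRel R (decomp b B R i) BothActive) (decomp b B R i v).1 = none := by
  induction j with
  | zero => exact absurd rfl h
  | succ j ih =>
    by_cases h0 : (decomp b B R j v).2 = 0
    · have h' : decomp b B R j v = ((decomp b B R j v).1, 0) := Prod.ext rfl h0
      cases hg : grow b B (quotRel R (decomp b B R j) BothActive) (decomp b B R j v).1 with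
      | none => exact ⟨j, by omega, by rw [decomp_succ_of_none h' hg], h0,
          by rw [decomp_succ_of_none h' hg], hg⟩
      | some z => rw [decomp_succ_of_some h' hg] at h; exact absurd rfl h
    · obtain ⟨i, hi, h1⟩ := ih h0
      rw [decomp_succ_of_retired h0]
      exact ⟨i, by omega, h1⟩

/-- A cluster with `b` active neighbors would lie within `2 * B` steps of the ruling set and be
absorbed, so a retiring one has fewer. For the clusters left at the end the bound comes from their
total number, at most `b`. -/
theorem exists_phase (hb : 1 ≤ b) (hR : ∀ x y, R x y → R y x)
    (hn : ∀ x y, R x y → x ∈ Finset.Icc 1 n) (hB : n < 2 ^ B) {k : ℕ} (hk : 1 ≤ k)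
    (hnb : n < (b + 1) ^ k) {v : ℕ} (hv : v ∈ Finset.Icc 1 n) :
    ∃ i < k, (finalDecomp b B k R v).2 = i + 1 ∧ (decomp b B R i v).2 = 0 ∧
      (decomp b B R i v).1 = (finalDecomp b B k R v).1 ∧
      {y | quotRel R (decomp b B R i) BothActive (decomp b B R i v).1 y}.ncard < b := by
  classical
  by_cases h : (decomp b B R (k - 1) v).2 = 0
  · refine ⟨k - 1, by omega, by simp only [finalDecomp, h, if_true]; omega, h, rfl, ?_⟩
    have hmem := mem_activeNames hb hR hn hv h
    have hsub : {y | quotRel R (decomp b B R (k - 1)) BothActive (decomp b B R (k - 1) v).1 y} ⊆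
        ((activeNames b B n R (k - 1)).erase (decomp b B R (k - 1) v).1 : Set ℕ) := by
      intro y hy
      rw [Finset.mem_coe, Finset.mem_erase]
      exact ⟨hy.1.symm, (mem_activeNames_of_quotRel hb hR hn hy).2⟩
    have h1 := Set.ncard_le_ncard hsub (Finset.finite_toSet _)
    rw [Set.ncard_coe_finset] at h1
    have h2 := Finset.card_erase_lt_of_mem hmem
    have h3 := card_activeNames_le hb hR hn hB hk hnb
    omega
  · obtain ⟨i, hi, h1, h2, h3, h4⟩ := exists_phase_of_retired h
    refine ⟨i, by omega, by simp only [finalDecomp, h, if_false]; exact h1, h2, h3, ?_⟩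
    by_contra hdeg
    obtain ⟨z, hz, hw⟩ := exists_ruling_within (b := b) (R := quotRel R (decomp b B R i) BothActive)
      (x := (decomp b B R i v).1) (not_lt.1 hdeg) B
    have := isSome_flood hz hw
    have h4' : flood (quotRel R (decomp b B R i) BothActive)
      (ruling b (quotRel R (decomp b B R i) BothActive) B) (2 * B) (decomp b B R i v).1 = none := h4
    rw [h4'] at this
    exact absurd this (by simp)

theorem active_of_le_mark {k i w : ℕ} (hi : i < k) (h : i + 1 ≤ (finalDecomp b B k R w).2) :
    (decomp b B R i w).2 = 0 := by
  by_contra h0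
  have h1 := decomp_of_retired (by omega : i ≤ k - 1) h0
  have h2 := decomp_mark_le (b := b) (B := B) (R := R) i w
  rw [finalDecomp, h1, if_neg h0] at h
  simp only at h
  omega

/-- The relation between the final clusters, directed towards the larger marks. -/
def upRel (b B k : ℕ) (R : ℕ → ℕ → Prop) : ℕ → ℕ → Prop :=
  quotRel R (finalDecomp b B k R) (· ≤ ·)

/-- A final neighbor of equal or larger mark was still active when this cluster retired. It
therefore contains one of the active neighbors of that moment, and later merging can only lower the
count. -/
theorem ncard_upRel_lt (hb : 1 ≤ b) (hR : ∀ x y, R x y → R y x)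
    (hn : ∀ x y, R x y → x ∈ Finset.Icc 1 n) (hB : n < 2 ^ B) {k : ℕ} (hk : 1 ≤ k)
    (hnb : n < (b + 1) ^ k) {v : ℕ} (hv : v ∈ Finset.Icc 1 n) :
    {y | upRel b B k R (finalDecomp b B k R v).1 y}.Finite ∧
      {y | upRel b B k R (finalDecomp b B k R v).1 y}.ncard < b := by
  obtain ⟨i, hi, h1, h2, h3, h4⟩ := exists_phase hb hR hn hB hk hnb hv
  have hfin := finite_quotRel (B := B) hb hR hn i (decomp b B R i v).1
  have hsub : {y | upRel b B k R (finalDecomp b B k R v).1 y} ⊆ (fun y => (finalDecomp b B k R y).1) ''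
      {y | quotRel R (decomp b B R i) BothActive (decomp b B R i v).1 y} := by
    rintro y ⟨hne, u, w, huw, hu, rfl, hle⟩
    have hu' := finalDecomp_eq_of_name_eq hb hu
    rw [hu', h1] at hle
    have hu0 : (decomp b B R i u).2 = 0 := active_of_le_mark hi (by rw [hu', h1])
    have hw0 : (decomp b B R i w).2 = 0 := active_of_le_mark hi hle
    obtain ⟨i', hi', g1, g2, g3, _⟩ := exists_phase hb hR hn hB hk hnb (hn _ _ huw)
    obtain rfl : i' = i := by rw [hu', h1] at g1; omega
    refine ⟨(decomp b B R i' w).1, ⟨?_, u, w, huw, ?_, rfl, hu0, hw0⟩, ?_⟩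
    · intro he
      rw [h3, ← hu, ← g3] at he
      exact hne (hu.symm.trans (congrArg Prod.fst
        (finalDecomp_congr hi (decomp_eq_of_name_eq hb he))))
    · rw [g3, hu, h3]
    · exact congrArg Prod.fst (finalDecomp_congr hi (decomp_name hb i' w))
  exact ⟨(hfin.image _).subset hsub,
    ((Set.ncard_le_ncard hsub (hfin.image _)).trans (Set.ncard_image_le hfin)).trans_lt h4⟩

end Counting

/-! ### Coloring along a relation -/

/-- The colors after `j` rounds of color reduction with the rules `φ`. -/
def colors (φ : ℕ → ℕ → Set ℕ → ℕ) (R : ℕ → ℕ → Prop) : ℕ → ℕ → ℕ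
  | 0, x => x
  | j + 1, x => φ j (colors φ R j x) {c | ∃ y, R x y ∧ colors φ R j y = c}

theorem isLocal_colors (φ : ℕ → ℕ → Set ℕ → ℕ) (j : ℕ) : IsLocal j fun R => colors φ R j := by
  induction j with
  | zero => exact fun _ _ _ _ => rfl
  | succ j ih =>
    intro R R' x h
    have h1 : colors φ R j x = colors φ R' j x := ih R R' x h.of_succ
    have h2 : {c | ∃ y, R x y ∧ colors φ R j y = c} = {c | ∃ y, R' x y ∧ colors φ R' j y = c} := by
      ext c
      refine exists_congr fun y => ?_
      rw [h.iff y]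
      refine and_congr_right fun hy => ?_
      have : colors φ R j y = colors φ R' j y := ih R R' y (h.neighbor ((h.iff y).2 hy))
      rw [this]
    simp only [colors, h1, h2]

/-- `R` need not be symmetric: a reducer separates a vertex from its out-neighbors, so one direction
per edge suffices. `P` singles out the true cluster names, where the degree bound is available. -/
theorem colors_spec {b J : ℕ} {μ : ℕ → ℕ} {φ : ℕ → ℕ → Set ℕ → ℕ} {R : ℕ → ℕ → Prop}
    {P : ℕ → Prop} (h0 : ∀ x, P x → x < μ 0)
    (hφ : ∀ j < J, IsColorReducer b (μ j) (μ (j + 1)) (φ j))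
    (hfin : ∀ x, P x → {y | R x y}.Finite ∧ {y | R x y}.ncard ≤ b)
    (hne : ∀ x y, R x y → x ≠ y ∧ P y) :
    (∀ x, P x → colors φ R J x < μ J) ∧
      ∀ x y, P x → R x y → colors φ R J x ≠ colors φ R J y := by
  induction J with
  | zero => exact ⟨h0, fun x y _ h => (hne x y h).1⟩
  | succ J ih =>
    obtain ⟨ih1, ih2⟩ := ih fun j hj => hφ j (by omega)
    have hred := hφ J (by omega)
    refine ⟨fun x _ => hred.1 _ _, fun x y hx hxy => ?_⟩
    have himg : {c | ∃ y, R x y ∧ colors φ R J y = c} = colors φ R J '' {y | R x y} := rfl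
    have hf := hfin x hx
    refine hred.2 _ (ih1 x hx) _ (ih1 y (hne x y hxy).2) _ _ ?_ ?_ ⟨y, hxy, rfl⟩ ?_
    · rw [himg]; exact hf.1.image _
    · rw [himg]; exact (Set.ncard_image_le hf.1).trans hf.2
    · rintro ⟨z, hz, he⟩
      exact ih2 x z hx hz he.symm

/-! ### Locality of the final clustering and of the colors -/

section FinalLocality

variable {b : ℕ}

theorem isGraphLocal_finalDecomp (hb : 1 ≤ b) (B k : ℕ) :
    IsGraphLocal (reach B (k - 1)) fun R => finalDecomp b B k R := by
  intro R R' hR hR' v h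
  have hv : decomp b B R (k - 1) v = decomp b B R' (k - 1) v :=
    isGraphLocal_decomp hb B (k - 1) R R' hR hR' v h
  simp only [finalDecomp, hv]

theorem isGraphLocal_colors_upRel (hb : 1 ≤ b) (B k : ℕ) (φ : ℕ → ℕ → Set ℕ → ℕ) (J : ℕ) :
    IsGraphLocal (reach B (k - 1) * (J + 1)) fun R v =>
      colors φ (upRel b B k R) J (finalDecomp b B k R v).1 := by
  intro R R' hR hR' v h
  obtain ⟨D, hDr, hD⟩ := exists_clusterRadiusLE_decomp hb B (k - 1)
  have hle : reach B (k - 1) + J * (2 * D + 1) ≤ reach B (k - 1) * (J + 1) := by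
    have := Nat.mul_le_mul_left J hDr
    nlinarith
  have hrad : ∀ R : ℕ → ℕ → Prop, (∀ x y, R x y → R y x) →
      ClusterRadiusLE R (finalDecomp b B k R) D := fun R hR => hD R hR
  have hv : finalDecomp b B k R v = finalDecomp b B k R' v :=
    isGraphLocal_finalDecomp hb B k R R' hR hR' v (h.mono (by nlinarith))
  have hq : Agree (upRel b B k R) (upRel b B k R') J (finalDecomp b B k R v).1 :=
    agree_quotRel hR hR' (fun v => isGraphLocal_finalDecomp hb B k R R' hR hR' v) (hrad R hR)
      (hrad R' hR') (h.mono hle)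
  have hc : colors φ (upRel b B k R) J (finalDecomp b B k R v).1 =
    colors φ (upRel b B k R') J (finalDecomp b B k R v).1 := isLocal_colors φ J _ _ _ hq
  exact hc.trans (by rw [hv])

end FinalLocality

/-! ### Clusters of a network -/

theorem Network.exists_walk_of_within {V : Type*} [Fintype V] (N : Network V) {name : V → ℕ}
    {f : ℕ → ℕ} (hname : ∀ v, name v = f (N.ident v)) {X : Quotient (partitionOfNames name)}
    {t : ℕ} (u v : cluster (partitionOfNames name) X)
    (h : Within (fun a b => N.rel a b ∧ f a = f b) t (N.ident u) (N.ident v)) :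
    ∃ p : (N.graph.induce (cluster (partitionOfNames name) X)).Walk u v, p.length ≤ t := by
  induction t generalizing u with
  | zero =>
    obtain rfl : u = v := Subtype.ext (N.ident_injective h)
    exact ⟨.nil, le_rfl⟩
  | succ t ih =>
    rcases h with h | ⟨w, ⟨⟨a, c, hac, ha, rfl⟩, hf⟩, hw⟩
    · obtain rfl : u = v := Subtype.ext (N.ident_injective h)
      exact ⟨.nil, Nat.zero_le _⟩
    · obtain rfl : a = u := N.ident_injective ha
      have hc : c ∈ cluster (partitionOfNames name) X := by
        refine Eq.trans (Quotient.sound ?_) u.2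
        change name c = name u
        rw [hname, hname, hf]
      obtain ⟨p, hp⟩ := ih ⟨c, hc⟩ hw
      exact ⟨.cons (v := ⟨c, hc⟩) (by simpa using hac) p, by simpa using hp⟩

/-- Greedy coloring by decreasing `h`: the neighbors colored before a vertex have `h` at least as
large, so they block fewer than `b` colors. -/
theorem colorable_of_ncard_lt {W : Type*} [Finite W] {α : Type*} [LinearOrder α]
    (G : SimpleGraph W) (h : W → α) {b : ℕ}
    (hdeg : ∀ x, {y | G.Adj x y ∧ h x ≤ h y}.ncard < b) : G.Colorable b := by
  classical
  have := Fintype.ofFinite W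
  rcases isEmpty_or_nonempty W with hW | ⟨⟨x₀⟩⟩
  · exact .of_isEmpty _
  have hb : 0 < b := (Nat.zero_le _).trans_lt (hdeg x₀)
  have H : ∀ s : Finset W, ∃ f : W → Fin b, ∀ x ∈ s, ∀ y ∈ s, G.Adj x y → f x ≠ f y := by
    intro s
    induction s using Finset.induction_on_min_value h with
    | empty => exact ⟨fun _ => ⟨0, hb⟩, by simp⟩
    | insert a s ha hmin ih =>
      obtain ⟨f, hf⟩ := ih
      have hlt : ((s.filter (G.Adj a)).image f).card < b := by
        refine Finset.card_image_le.trans_lt (lt_of_le_of_lt ?_ (hdeg a))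
        rw [← Set.ncard_coe_finset]
        refine Set.ncard_le_ncard (fun y hy => ?_) (Set.toFinite _)
        rw [Finset.mem_coe, Finset.mem_filter] at hy
        exact ⟨hy.2, hmin y hy.1⟩
      obtain ⟨c, hc⟩ : ∃ c, c ∉ (s.filter (G.Adj a)).image f := by
        by_contra! hno
        have := Finset.card_le_card (fun c _ => hno c : (Finset.univ : Finset (Fin b)) ⊆ _)
        rw [Finset.card_univ, Fintype.card_fin] at this
        omega
      have hc' : ∀ y ∈ s, G.Adj a y → f y ≠ c := fun y hy hay he =>
        hc (Finset.mem_image.2 ⟨y, Finset.mem_filter.2 ⟨hy, hay⟩, he⟩)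
      refine ⟨Function.update f a c, fun x hx y hy hxy => ?_⟩
      rcases Finset.mem_insert.1 hx with rfl | hxs <;> rcases Finset.mem_insert.1 hy with rfl | hys
      · exact absurd hxy G.irrefl
      · rw [Function.update_self, Function.update_of_ne (by rintro rfl; exact ha hys)]
        exact (hc' y hys hxy).symm
      · rw [Function.update_self, Function.update_of_ne (by rintro rfl; exact ha hxs)]
        exact hc' x hxs hxy.symm
      · rw [Function.update_of_ne (by rintro rfl; exact ha hxs),
          Function.update_of_ne (by rintro rfl; exact ha hys)]
        exact hf x hxs y hys hxy
  obtain ⟨f, hf⟩ := H Finset.univ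
  exact ⟨SimpleGraph.Coloring.mk f fun {x y} hxy => hf x (Finset.mem_univ _) y (Finset.mem_univ _) hxy⟩

/-! ### Arithmetic -/

/-- The integer part of the `k`-th root of `n`. -/
noncomputable def floorRoot (n k : ℕ) : ℕ := ⌊(n : ℝ) ^ (1 / (k : ℝ))⌋₊

theorem floorRoot_le (n k : ℕ) : (floorRoot n k : ℝ) ≤ (n : ℝ) ^ (1 / (k : ℝ)) :=
  Nat.floor_le (by positivity)

theorem floorRoot_pow_le {n k : ℕ} (hk : 1 ≤ k) : floorRoot n k ^ k ≤ n := by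
  have h := pow_le_pow_left₀ (by positivity) (floorRoot_le n k) k
  rw [one_div, Real.rpow_inv_natCast_pow (by positivity) (by omega)] at h
  exact_mod_cast h

theorem lt_floorRoot_succ_pow {n k : ℕ} (hk : 1 ≤ k) : n < (floorRoot n k + 1) ^ k := by
  have h := pow_lt_pow_left₀ (Nat.lt_floor_add_one ((n : ℝ) ^ (1 / (k : ℝ)))) (by positivity)
    (show k ≠ 0 by omega)
  rw [one_div, Real.rpow_inv_natCast_pow (by positivity) (by omega), ← one_div] at h
  exact_mod_cast h

theorem one_le_floorRoot {n k : ℕ} (hn : 1 ≤ n) : 1 ≤ floorRoot n k := by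
  refine Nat.le_floor ?_
  rw [Nat.cast_one]
  exact Real.one_le_rpow (by exact_mod_cast hn) (by positivity)

theorem floorRoot_sq_le (n k : ℕ) : (floorRoot n k : ℝ) ^ 2 ≤ (n : ℝ) ^ (2 / (k : ℝ)) := by
  have h : (n : ℝ) ^ (2 / (k : ℝ)) = ((n : ℝ) ^ (1 / (k : ℝ))) ^ 2 := by
    rw [← Real.rpow_mul_natCast (by positivity)]
    congr 1
    push_cast
    ring
  rw [h]
  exact pow_le_pow_left₀ (by positivity) (floorRoot_le n k) 2

/-- With `L` the rounded logarithm, `8 * L + 3 = 8 * (L - 1) + 11`; both `L - 1` and `1` are at most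
`log n / log 2`, and `19 / log 2 < 32`. -/
theorem clog_succ_le {n : ℕ} (hn : 2 ≤ n) :
    8 * (Nat.clog 2 (n + 1) : ℝ) + 3 ≤ 32 * Real.log n := by
  have h1 : 2 ^ (Nat.clog 2 (n + 1) - 1) ≤ n :=
    Nat.lt_succ_iff.1 (Nat.pow_pred_clog_lt_self (by norm_num) (by omega))
  have hpos : 0 < Nat.clog 2 (n + 1) := Nat.clog_pos (by norm_num) (by omega)
  have h2 : ((Nat.clog 2 (n + 1) - 1 : ℕ) : ℝ) * Real.log 2 ≤ Real.log n := by
    rw [← Real.log_pow]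
    exact Real.log_le_log (by positivity) (by exact_mod_cast h1)
  have h3 : Real.log 2 ≤ Real.log n := Real.log_le_log (by norm_num) (by exact_mod_cast hn)
  have h4 := Real.log_two_gt_d9
  rw [Nat.cast_sub hpos, Nat.cast_one] at h2
  have h5 : (0 : ℝ) ≤ (Nat.clog 2 (n + 1) : ℝ) - 1 := by
    have : (1 : ℝ) ≤ (Nat.clog 2 (n + 1) : ℝ) := by exact_mod_cast hpos
    linarith
  nlinarith

theorem one_le_logStar {n : ℕ} (hn : 2 ≤ n) : 1 ≤ logStar n := by
  by_contra h
  have h0 : logStar n = 0 := by omega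
  rcases Nat.sInf_eq_zero.1 h0 with h1 | h1
  · have : (n : ℝ) ≤ 1 := h1
    have : (2 : ℝ) ≤ n := by exact_mod_cast hn
    linarith
  · obtain ⟨i, hi⟩ := exists_iterate_logb_le_one n
    exact (Set.eq_empty_iff_forall_notMem.1 h1) i hi

/-- A round factor of size `K ^ (k - 1)` is absorbed into the constant at the base of the power. -/
theorem reach_mul_le {n k m K : ℕ} (hn : 2 ≤ n) (hm : m ≤ K ^ (k - 1)) :
    ((reach (Nat.clog 2 (n + 1)) (k - 1) * m : ℕ) : ℝ) ≤ (32 * K * Real.log n) ^ (k - 1) := by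
  have h1 := pow_le_pow_left₀ (by positivity) (clog_succ_le hn) (k - 1)
  have h2 : (m : ℝ) ≤ (K : ℝ) ^ (k - 1) := by exact_mod_cast hm
  have h3 : (32 * K * Real.log n) ^ (k - 1) = (32 * Real.log n) ^ (k - 1) * (K : ℝ) ^ (k - 1) := by
    rw [← mul_pow]; congr 1; ring
  rw [h3, reach]
  push_cast
  have h4 : 0 ≤ Real.log n := Real.log_natCast_nonneg n
  exact mul_le_mul h1 h2 (by positivity) (by positivity)

/-! ### The decomposition of a network -/

theorem Network.rel_mem {V : Type*} [Fintype V] (N : Network V) (x y : ℕ) (h : N.rel x y) :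
    x ∈ Finset.Icc 1 (Fintype.card V) := by
  obtain ⟨u, _, _, rfl, _⟩ := h
  exact Finset.mem_Icc.2 (N.ident_mem u)

/-- The name of a cluster of the decomposition. -/
def clusterName {V : Type*} (name : V → ℕ) : Quotient (partitionOfNames name) → ℕ :=
  Quotient.lift name fun _ _ h => h

theorem clusterName_injective {V : Type*} (name : V → ℕ) : Function.Injective (clusterName name) := by
  intro X Y h
  induction X using Quotient.inductionOn
  induction Y using Quotient.inductionOn
  exact Quotient.sound h

section NetworkDecomposition

variable {V : Type*} [Fintype V] (N : Network V) {b B k : ℕ} {name : V → ℕ}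

theorem Network.strongDiameterLE (hb : 1 ≤ b)
    (hname : ∀ v, name v = (finalDecomp b B k N.rel (N.ident v)).1) :
    StrongDiameterLE N.graph (partitionOfNames name) (reach B (k - 1)) := by
  obtain ⟨D, hDr, hD⟩ := exists_clusterRadiusLE_decomp hb B (k - 1)
  have hrad : ClusterRadiusLE N.rel (finalDecomp b B k N.rel) D := hD N.rel N.rel_symm
  intro X u v
  have huv : name u = name v := Quotient.exact (u.2.trans v.2.symm)
  rw [hname, hname] at huv
  obtain ⟨p, hp⟩ := N.exists_walk_of_within hname u v (hrad.within N.rel_symm huv)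
  exact ⟨p, by exact_mod_cast (by omega : p.length ≤ reach B (k - 1))⟩

theorem Network.upRel_of_adj (hb : 1 ≤ b)
    (hname : ∀ v, name v = (finalDecomp b B k N.rel (N.ident v)).1) {u v : V}
    (h : (supergraph N.graph (partitionOfNames name)).Adj (Quotient.mk _ u) (Quotient.mk _ v))
    (hle : (finalDecomp b B k N.rel (N.ident u)).2 ≤ (finalDecomp b B k N.rel (N.ident v)).2) :
    upRel b B k N.rel (name u) (name v) := by
  obtain ⟨hne, u', hu, v', hv, hadj⟩ := h
  have hu' : name u' = name u := Quotient.exact hu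
  have hv' : name v' = name v := Quotient.exact hv
  refine ⟨fun h => hne (Quotient.sound h), N.ident u', N.ident v', ⟨u', v', hadj, rfl, rfl⟩,
    (hname u').symm.trans hu', (hname v').symm.trans hv', ?_⟩
  rw [hname, hname] at hu' hv'
  rwa [finalDecomp_eq_of_name_eq hb hu', finalDecomp_eq_of_name_eq hb hv']

theorem Network.exists_mark (hb : 1 ≤ b) (hB : Fintype.card V < 2 ^ B) (hk : 1 ≤ k)
    (hnb : Fintype.card V < (b + 1) ^ k)
    (hname : ∀ v, name v = (finalDecomp b B k N.rel (N.ident v)).1) :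
    ∃ h : Quotient (partitionOfNames name) → Fin k,
      (∀ v, (finalDecomp b B k N.rel (N.ident v)).2 = (h (Quotient.mk _ v) : ℕ) + 1) ∧
      ∀ X, {Y | (supergraph N.graph (partitionOfNames name)).Adj X Y ∧ h X ≤ h Y}.ncard < b := by
  have hmark : ∀ v : V, ∃ i : Fin k, (finalDecomp b B k N.rel (N.ident v)).2 = i + 1 := by
    intro v
    obtain ⟨i, hi, h1, _⟩ := exists_phase hb N.rel_symm N.rel_mem hB hk hnb
      (Finset.mem_Icc.2 (N.ident_mem v))
    exact ⟨⟨i, hi⟩, h1⟩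
  choose m hm using hmark
  have hm_congr : ∀ u v, (partitionOfNames name) u v → m u = m v := by
    intro u v huv
    have h1 : name u = name v := huv
    rw [hname, hname] at h1
    have h2 := congrArg Prod.snd (finalDecomp_eq_of_name_eq hb h1)
    rw [hm, hm] at h2
    exact Fin.ext (by omega)
  refine ⟨Quotient.lift m hm_congr, hm, fun X => ?_⟩
  induction X using Quotient.inductionOn with
  | _ u =>
    obtain ⟨hfin, hlt⟩ := ncard_upRel_lt hb N.rel_symm N.rel_mem hB hk hnb
      (Finset.mem_Icc.2 (N.ident_mem u))
    refine lt_of_le_of_lt (Set.ncard_le_ncard_of_injOn (clusterName name) ?_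
      (clusterName_injective name).injOn hfin) hlt
    rintro Y ⟨hadj, hle⟩
    induction Y using Quotient.inductionOn with
    | _ v =>
      have hle' : m u ≤ m v := hle
      have := N.upRel_of_adj hb hname hadj (by rw [hm, hm]; exact Nat.succ_le_succ hle')
      rw [hname u] at this
      exact this

theorem Network.exists_label (hb : 1 ≤ b) (hB : Fintype.card V < 2 ^ B) (hk : 1 ≤ k)
    (hnb : Fintype.card V < (b + 1) ^ k)
    (hname : ∀ v, name v = (finalDecomp b B k N.rel (N.ident v)).1) {J : ℕ} {μ : ℕ → ℕ}
    {φ : ℕ → ℕ → Set ℕ → ℕ} (hμ : μ 0 = Fintype.card V + 1)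
    (hφ : ∀ j < J, IsColorReducer b (μ j) (μ (j + 1)) (φ j)) {L : ℝ} (hL : μ J ≤ L) :
    ∃ lab : Quotient (partitionOfNames name) → ℕ,
      (∀ v, colors φ (upRel b B k N.rel) J (name v) + 1 = lab (Quotient.mk _ v)) ∧
      IsLabeling N.graph (partitionOfNames name) lab L := by
  obtain ⟨h1, h2⟩ := colors_spec (R := upRel b B k N.rel)
    (P := fun x => ∃ v ∈ Finset.Icc 1 (Fintype.card V), (finalDecomp b B k N.rel v).1 = x)
    (by
      rintro x ⟨v, hv, rfl⟩
      have := Finset.mem_Icc.1 (decomp_name_mem (B := B) hb N.rel_symm N.rel_mem hv (k - 1))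
      rw [hμ]
      exact Nat.lt_succ_of_le this.2) hφ
    (by
      rintro x ⟨v, hv, rfl⟩
      obtain ⟨h1, h2⟩ := ncard_upRel_lt hb N.rel_symm N.rel_mem hB hk hnb hv
      exact ⟨h1, h2.le⟩)
    (by
      rintro x y ⟨hne, u, w, huw, _, hw, _⟩
      exact ⟨hne, w, N.rel_mem _ _ (N.rel_symm _ _ huw), hw⟩)
  have hP : ∀ v, ∃ u ∈ Finset.Icc 1 (Fintype.card V), (finalDecomp b B k N.rel u).1 = name v :=
    fun v => ⟨N.ident v, Finset.mem_Icc.2 (N.ident_mem v), (hname v).symm⟩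
  -- Colors start at `0`, labels at `1`. The marks of adjacent clusters are comparable, so `upRel`
  -- covers every edge in some direction.
  refine ⟨fun X => colors φ (upRel b B k N.rel) J (clusterName name X) + 1, fun v => rfl, ?_, ?_⟩
  · intro X
    induction X using Quotient.inductionOn with
    | _ v => exact ⟨Nat.le_add_left _ _, le_trans (by exact_mod_cast h1 _ (hP v)) hL⟩
  · intro X Y hadj he
    induction X using Quotient.inductionOn with
    | _ u =>
    induction Y using Quotient.inductionOn with
    | _ v =>
      have he' : colors φ (upRel b B k N.rel) J (name u) = colors φ (upRel b B k N.rel) J (name v) :=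
        Nat.succ_injective he
      rcases le_total (finalDecomp b B k N.rel (N.ident u)).2
        (finalDecomp b B k N.rel (N.ident v)).2 with h | h
      · exact h2 _ _ (hP u) (N.upRel_of_adj hb hname hadj h) he'
      · exact h2 _ _ (hP v) (N.upRel_of_adj hb hname hadj.symm h) he'.symm

end NetworkDecomposition

/-! ### Outputs of the two algorithms and final assembly -/

/-- The number of binary digits of the identity numbers. -/
def idBits (n : ℕ) : ℕ := Nat.clog 2 (n + 1)

/-- The output of the decomposition algorithm: cluster name and index of the H-set. -/
noncomputable def decompOutput (n k : ℕ) (R : ℕ → ℕ → Prop) (v : ℕ) : ℕ × ℕ :=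
  if n ≤ 1 then (1, 1) else finalDecomp (floorRoot n k) (idBits n) k R v

/-- The output of the labeling algorithm that uses `J` rounds of color reduction with the rules
`φ`: cluster name and label. -/
noncomputable def labelOutput (J : ℕ) (φ : ℕ → ℕ → Set ℕ → ℕ) (n k : ℕ) (R : ℕ → ℕ → Prop)
    (v : ℕ) : ℕ × ℕ :=
  if n ≤ 1 then (1, 1) else
    ((finalDecomp (floorRoot n k) (idBits n) k R v).1,
      colors φ (upRel (floorRoot n k) (idBits n) k R) J
        (finalDecomp (floorRoot n k) (idBits n) k R v).1 + 1)

/-- The algorithm is fixed before `n`, `k` and the network are given, so the reduction rules are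
chosen once for all as functions of `n` and `k`. -/
theorem exists_colorReduction_schedule : ∃ (J : ℕ → ℕ → ℕ) (μ : ℕ → ℕ → ℕ → ℕ)
    (φ : ℕ → ℕ → ℕ → ℕ → Set ℕ → ℕ), ∀ n k, 2 ≤ n → 1 ≤ k →
      J n k + 1 ≤ (2 ^ 35) ^ (k - 1) ∧ μ n k 0 = n + 1 ∧
      μ n k (J n k) ≤ 2 ^ 16 * floorRoot n k ^ 2 ∧
      ∀ j < J n k, IsColorReducer (floorRoot n k) (μ n k j) (μ n k (j + 1)) (φ n k j) := by
  have h : ∀ n k, ∃ (J : ℕ) (μ : ℕ → ℕ) (φ : ℕ → ℕ → Set ℕ → ℕ), 2 ≤ n → 1 ≤ k →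
      J + 1 ≤ (2 ^ 35) ^ (k - 1) ∧ μ 0 = n + 1 ∧ μ J ≤ 2 ^ 16 * floorRoot n k ^ 2 ∧
      ∀ j < J, IsColorReducer (floorRoot n k) (μ j) (μ (j + 1)) (φ j) := by
    intro n k
    by_cases hnk : 2 ≤ n ∧ 1 ≤ k
    · obtain ⟨J, hJ, m', hm', μ, φ, h0, hm, hφ⟩ := exists_short_colorReductionChain hnk.1 hnk.2
        (floorRoot_pow_le hnk.2) (lt_floorRoot_succ_pow hnk.2)
      exact ⟨J, μ, φ, fun _ _ => ⟨hJ, h0, hm ▸ hm', hφ⟩⟩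
    · exact ⟨0, fun _ => 0, fun _ _ _ => 0, fun h1 h2 => absurd ⟨h1, h2⟩ hnk⟩
  choose J μ φ h using h
  exact ⟨J, μ, φ, h⟩

theorem mainTheorem8 :
    ∃ C : ℝ, 0 < C ∧
    -- `A` outputs at each vertex a cluster name and an index of an H-set,
    -- `B` outputs a cluster name and a label
    ∃ (A B : DistributedAlgorithm (ℕ × ℕ)),
      ∀ (k : ℕ), 1 ≤ k → ∀ (V : Type) [Fintype V] (N : Network V),
        ∃ (name index label : V → ℕ),
          A.ComputesWithin N k ((C * Real.log (Fintype.card V)) ^ (k - 1))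
            (fun v => (name v, index v)) ∧
          IsStrongNetworkDecomposition N.graph (partitionOfNames name)
            ((C * Real.log (Fintype.card V)) ^ (k - 1))
            ((Fintype.card V : ℝ) ^ (1 / (k : ℝ))) ∧
          (∃ h : Quotient (partitionOfNames name) → Fin k,
            (∀ v, index v = (h (Quotient.mk _ v) : ℕ) + 1) ∧
            IsHPartition (supergraph N.graph (partitionOfNames name)) h
              (C * (Fintype.card V : ℝ) ^ (1 / (k : ℝ)))) ∧
          B.ComputesWithin N k
            ((C * Real.log (Fintype.card V)) ^ (k - 1) * logStar (Fintype.card V))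
            (fun v => (name v, label v)) ∧
          (∃ lab : Quotient (partitionOfNames name) → ℕ,
            (∀ v, label v = lab (Quotient.mk _ v)) ∧
            IsLabeling N.graph (partitionOfNames name) lab
              (C * (Fintype.card V : ℝ) ^ (2 / (k : ℝ)))) := by
  obtain ⟨J, μ, φ, hsched⟩ := exists_colorReduction_schedule
  refine ⟨32 * (2 ^ 35 : ℕ), by positivity,
    -- For `n ≤ 1` the logarithm and `log* n` vanish, so the time bounds can be `0` and the answer
    -- must be given without any round.
    gather (fun n k => if n ≤ 1 then 0 else reach (idBits n) (k - 1)) decompOutput,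
    gather (fun n k => if n ≤ 1 then 0 else reach (idBits n) (k - 1) * (J n k + 1))
      fun n k => labelOutput (J n k) (φ n k) n k, ?_⟩
  intro k hk V _ N
  set C : ℝ := 32 * (2 ^ 35 : ℕ) with hC
  have hlog : 0 ≤ Real.log (Fintype.card V) := Real.log_natCast_nonneg _
  refine ⟨fun v => (decompOutput (Fintype.card V) k N.rel (N.ident v)).1,
    fun v => (decompOutput (Fintype.card V) k N.rel (N.ident v)).2,
    fun v => (labelOutput (J (Fintype.card V) k) (φ (Fintype.card V) k) (Fintype.card V) k N.rel
      (N.ident v)).2, ?_⟩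
  rcases le_or_gt (Fintype.card V) 1 with hn | hn
  · have hsub : Subsingleton V := Fintype.card_le_one_iff_subsingleton.1 hn
    have hnoadj : ∀ {name : V → ℕ} X Y, ¬ (supergraph N.graph (partitionOfNames name)).Adj X Y := by
      intro name X Y h
      induction X using Quotient.inductionOn
      induction Y using Quotient.inductionOn
      exact h.1 (congrArg _ (Subsingleton.elim _ _))
    refine ⟨gather_computesWithin _ _ N k ?_ ?_, ⟨?_, Fintype.card V, ?_, ?_⟩,
      ⟨fun _ => ⟨0, hk⟩, ?_, ?_⟩, ?_, ⟨fun _ => 1, ?_, ?_, ?_⟩⟩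
    · intro R R' _ _ v _
      simp only [decompOutput, if_pos hn]
    · simp only [if_pos hn, Nat.cast_zero]
      positivity
    · intro X u v
      obtain rfl : u = v := Subsingleton.elim u v
      exact ⟨.nil, by simpa using by positivity⟩
    · rcases Nat.le_one_iff_eq_zero_or_eq_one.1 hn with h | h
      · rw [h, Nat.cast_zero]; positivity
      · rw [h, Nat.cast_one, Real.one_rpow]
    · rcases isEmpty_or_nonempty V with hV | hV
      · exact .of_isEmpty _
      · exact ⟨SimpleGraph.Coloring.mk (fun _ => ⟨0, Fintype.card_pos⟩)
          fun h => absurd h (hnoadj _ _)⟩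
    · intro v
      simp only [decompOutput, if_pos hn]
    · intro X
      have : {Y | (supergraph N.graph (partitionOfNames fun v =>
          (decompOutput (Fintype.card V) k N.rel (N.ident v)).1)).Adj X Y ∧
          (⟨0, hk⟩ : Fin k) ≤ ⟨0, hk⟩} = ∅ := Set.eq_empty_of_forall_notMem fun Y h => hnoadj _ _ h.1
      rw [this, Set.ncard_empty, Nat.cast_zero]
      positivity
    · have h := gather_computesWithin
        (fun n k => if n ≤ 1 then 0 else reach (idBits n) (k - 1) * (J n k + 1))
        (fun n k => labelOutput (J n k) (φ n k) n k) N k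
        (T := (C * Real.log (Fintype.card V)) ^ (k - 1) * logStar (Fintype.card V))
        (fun R R' _ _ v _ => by simp only [labelOutput, if_pos hn])
        (by simp only [if_pos hn, Nat.cast_zero]; positivity)
      simpa only [labelOutput, decompOutput, if_pos hn] using h
    · intro v
      simp only [labelOutput, if_pos hn]
    · intro X
      induction X using Quotient.inductionOn with
      | _ v =>
        have : Fintype.card V = 1 := le_antisymm hn (Fintype.card_pos_iff.2 ⟨v⟩)
        rw [this, Nat.cast_one, Real.one_rpow, hC]
        norm_num
    · exact fun X Y h => absurd h (hnoadj _ _)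
  · have hn2 : 2 ≤ Fintype.card V := hn
    have hn1 : ¬ Fintype.card V ≤ 1 := by omega
    have hb : 1 ≤ floorRoot (Fintype.card V) k := one_le_floorRoot (by omega)
    have hB : Fintype.card V < 2 ^ idBits (Fintype.card V) :=
      Nat.le_pow_clog (by norm_num) _
    have hnb := lt_floorRoot_succ_pow (n := Fintype.card V) hk
    obtain ⟨hJ, hμ0, hμJ, hφ⟩ := hsched (Fintype.card V) k hn2 hk
    have hname : ∀ v, (decompOutput (Fintype.card V) k N.rel (N.ident v)).1 =
        (finalDecomp (floorRoot (Fintype.card V) k) (idBits (Fintype.card V)) k N.rel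
          (N.ident v)).1 := fun v => by rw [decompOutput, if_neg hn1]
    have hreach : (reach (idBits (Fintype.card V)) (k - 1) : ℝ) ≤
        (C * Real.log (Fintype.card V)) ^ (k - 1) := by
      have := reach_mul_le (m := 1) (K := 2 ^ 35) hn2 (k := k) (Nat.one_le_pow _ _ (by norm_num))
      rwa [mul_one] at this
    have hreachJ := reach_mul_le hn2 hJ
    have hC1 : (2 : ℝ) ^ 16 ≤ C := by rw [hC]; norm_num
    obtain ⟨h, hh, hdeg⟩ := N.exists_mark hb hB hk hnb hname
    obtain ⟨lab, hlab, hlabel⟩ := N.exists_label hb hB hk hnb hname hμ0 hφ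
      (L := C * (Fintype.card V : ℝ) ^ (2 / (k : ℝ))) (by
        have h1 : (μ (Fintype.card V) k (J (Fintype.card V) k) : ℝ) ≤
            2 ^ 16 * (floorRoot (Fintype.card V) k : ℝ) ^ 2 := by exact_mod_cast hμJ
        exact h1.trans (mul_le_mul hC1 (floorRoot_sq_le _ _) (by positivity) (by positivity)))
    refine ⟨gather_computesWithin _ _ N k ?_ ?_, ⟨fun X u v => ?_, _, floorRoot_le _ _,
      colorable_of_ncard_lt _ h hdeg⟩, ⟨h, ?_, fun X => ?_⟩, ?_, lab, ?_, hlabel⟩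
    · simp only [if_neg hn1]
      intro R R' hR hR' v hag
      simp only [decompOutput, if_neg hn1]
      exact isGraphLocal_finalDecomp hb _ k R R' hR hR' v hag
    · simpa only [if_neg hn1] using hreach
    · obtain ⟨p, hp⟩ := N.strongDiameterLE hb hname X u v
      exact ⟨p, hp.trans hreach⟩
    · intro v
      rw [← hh]
      simp only [decompOutput, if_neg hn1]
    · refine le_trans ?_ (mul_le_mul_of_nonneg_right (show 1 ≤ C by linarith) (by positivity))
      rw [one_mul]
      exact le_trans (by exact_mod_cast (hdeg X).le) (floorRoot_le (Fintype.card V) k)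
    · have hcomp := gather_computesWithin
        (fun n k => if n ≤ 1 then 0 else reach (idBits n) (k - 1) * (J n k + 1))
        (fun n k => labelOutput (J n k) (φ n k) n k) N k
        (T := (C * Real.log (Fintype.card V)) ^ (k - 1) * logStar (Fintype.card V))
        (by
          simp only [if_neg hn1]
          intro R R' hR hR' v hag
          simp only [labelOutput, if_neg hn1]
          have h1 := isGraphLocal_colors_upRel hb (idBits (Fintype.card V)) k
            (φ (Fintype.card V) k) (J (Fintype.card V) k) R R' hR hR' v hag
          have h2 := isGraphLocal_finalDecomp hb (idBits (Fintype.card V)) k R R' hR hR' v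
            (hag.mono (Nat.le_mul_of_pos_right _ (Nat.succ_pos _)))
          simp only at h1 h2
          rw [h1, h2])
        (by
          simp only [if_neg hn1]
          -- The bound holds even without the factor `log* n`, which is only needed to be at least
          -- `1`.
          refine hreachJ.trans (le_mul_of_one_le_right (by positivity) ?_)
          exact_mod_cast one_le_logStar hn2)
      simpa only [labelOutput, decompOutput, if_neg hn1] using hcomp
    · intro v
      rw [← hlab]
      simp only [labelOutput, if_neg hn1, hname]
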